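/- Let $\mathbb K$ be an algebraically closed field. Let $I$ be a finite set with a Borcherds-Cartan datum: an integer matrix $(a_{ij})_{i,j\in I}$ with $a_{ii}\in\{2,0,-2,-4,\dots\}$ and $a_{ij}\le 0$ for $i\neq j$, and positive integers $r_i$ such that $i\cdot j:=r_ia_{ij}=r_ja_{ji}$ for all $i,j\in I$. Write $I^+=\{i: a_{ii}=2\}$ and $I^-=\{i: a_{ii}\le 0\}$. Let $\nu=\sum_{i\in I}\nu(i)\,i\in\mathbb N[I]$ have height $n=\sum_i\nu(i)$, and let $\mathrm{Seq}(\nu)$ be the set of sequences $\mathbf i=i_1\cdots i_n$ in $I$ in which each $i\in I$ occurs exactly $\nu(i)$ times. Let $R(\nu)$ be the unital graded $\mathbb K$-algebra generated by the elements $1_{\mathbf i}$ (degree $0$), $x_{k,\mathbf i}$ for $1\le k\le n$ (degree $2r_{i_k}$) and $\tau_{k,\mathbf i}$ for $1\le k\le n-1$ (degree $-i_k\cdot i_{k+1}$), where $\mathbf i\in\mathrm{Seq}(\nu)$, subject to the following relations. The $1_{\mathbf i}$ are orthogonal idempotents with sum $1$; $x_{k,\mathbf i}=1_{\mathbf i}x_{k,\mathbf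 i}1_{\mathbf i}$ and $\tau_{k,\mathbf i}=1_{s_k\mathbf i}\tau_{k,\mathbf i}1_{\mathbf i}$, where $s_k$ exchanges the $k$-th and $(k+1)$-st entries; and, with $x_k=\sum_{\mathbf i}x_{k,\mathbf i}$ and $\tau_k=\sum_{\mathbf i}\tau_{k,\mathbf i}$: 1. $x_kx_l=x_lx_k$; $\tau_k\tau_l=\tau_l\tau_k$ if $|k-l|>1$; $x_l\tau_k=\tau_kx_l$ if $l\ne k,k+1$. 2. $\tau_k^21_{\mathbf i}=0$ if $i_k=i_{k+1}$; $\tau_k^21_{\mathbf i}=1_{\mathbf i}$ if $i_k\ne i_{k+1}$ and $i_k\cdot i_{k+1}=0$; $\tau_k^21_{\mathbf i}=(x_k^{-a_{ij}}+x_{k+1}^{-a_{ji}})1_{\mathbf i}$ if $i=i_k\neq j=i_{k+1}$ and $i\cdot j\neq 0$. 3. $(x_k\tau_k-\tau_kx_{k+1})1_{\mathbf i}=(\tau_kx_k-x_{k+1}\tau_k)1_{\mathbf i}$, and this element is $1_{\mathbf i}$ if $i_k=i_{k+1}\in I^+$ and $0$ otherwise. 4. $(\tau_k\tau_{k+1}\tau_k-\tau_{k+1}\tau_k\tau_{k+1})1_{\mathbf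 i}=\sum_{c=0}^{-a_{ij}-1}x_k^{c}x_{k+2}^{-a_{ij}-1-c}1_{\mathbf i}$ if $i_k=i_{k+2}=i\in I^+$, $i_{k+1}=j\ne i$ and $i\cdot j\neq0$; and it is $0$ for all other $(i_k,i_{k+1},i_{k+2})$. Write $\nu=\nu_1i_1+\cdots+\nu_ti_t$ with $i_1,\dots,i_t\in I$ distinct and all $\nu_k>0$. Then the center of $R(\nu)$ is isomorphic, as a graded $\mathbb K$-algebra, to $$\bigotimes_{k=1}^{t}\mathbb K[z_1,\dots,z_{\nu_k}]^{S_{\nu_k}},$$ where the variables of the $k$-th tensor factor have degree $2r_{i_k}$. -/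

import Mathlib

open scoped TensorProduct

/-- A Borcherds-Cartan datum on `I`: an integer matrix `a` with diagonal entries
`2, 0, -2, -4, …` and nonpositive off-diagonal entries, together with positive integers `r i`
such that `diag(r) * a` is symmetric. -/
structure BorcherdsCartanDatum (I : Type*) where
  a : I → I → ℤ
  r : I → ℤ
  diag : ∀ i, a i i = 2 ∨ (a i i ≤ 0 ∧ Even (a i i))
  off_diag : ∀ i j, i ≠ j → a i j ≤ 0
  r_pos : ∀ i, 0 < r i
  symm : ∀ i j, r i * a i j = r j * a j i

namespace BorcherdsCartanDatum

/-- The values `i · j = r i * a i j` on basis vectors of the symmetric bilinear form on `ℤ[I]`. -/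
def form {I : Type*} (D : BorcherdsCartanDatum I) (i j : I) : ℤ := D.r i * D.a i j

end BorcherdsCartanDatum

namespace QuiverHecke

section

variable {I : Type*} [Fintype I] [DecidableEq I]

/-- The height `ht(ν) = ∑ i, ν i` of `ν ∈ ℕ[I]`. -/
def ht (ν : I → ℕ) : ℕ := ∑ i, ν i

/-- `Seq(ν)`: sequences of length `ht ν` in which each `i` occurs exactly `ν i` times. -/
abbrev Seq (ν : I → ℕ) : Type _ :=
  {s : Fin (ht ν) → I // ∀ i, (Finset.univ.filter fun p => s p = i).card = ν i}

/-- The sequence `s_k(s)`, with the entries at (zero-based) positions `k` and `k + 1` exchanged. -/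
def Seq.swap {ν : I → ℕ} (k : ℕ) (hk : k + 1 < ht ν) (s : Seq ν) : Seq ν :=
  ⟨fun p => s.1 (Equiv.swap ⟨k, Nat.lt_of_succ_lt hk⟩ ⟨k + 1, hk⟩ p), fun i => by
    rw [← s.2 i]
    exact Finset.card_equiv (Equiv.swap ⟨k, Nat.lt_of_succ_lt hk⟩ ⟨k + 1, hk⟩) (by simp)⟩

/-- The elementary diagrams: `idem s` is `1_s`, `dot k s` is `x_{k,s}` (a dot on strand `k`), and
`cross k hk s` is `τ_{k,s}` (strands `k` and `k + 1` cross; bottom `s`, top `s_k(s)`).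
Strands are numbered from `0`. -/
inductive Gen (ν : I → ℕ) : Type _
  | idem (s : Seq ν) : Gen ν
  | dot (k : Fin (ht ν)) (s : Seq ν) : Gen ν
  | cross (k : ℕ) (hk : k + 1 < ht ν) (s : Seq ν) : Gen ν

/-- The degree of an elementary diagram. -/
def Gen.deg (D : BorcherdsCartanDatum I) {ν : I → ℕ} : Gen ν → ℤ
  | .idem _ => 0
  | .dot k s => 2 * D.r (s.1 k)
  | .cross k hk s => - D.form (s.1 ⟨k, by omega⟩) (s.1 ⟨k + 1, hk⟩)

variable (K : Type*) [Field K]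

/-- `1_s` in the free algebra. -/
def fe {ν : I → ℕ} (s : Seq ν) : FreeAlgebra K (Gen ν) := FreeAlgebra.ι K (.idem s)

/-- `x_{k,s}` in the free algebra. -/
def fx {ν : I → ℕ} (k : ℕ) (hk : k < ht ν) (s : Seq ν) : FreeAlgebra K (Gen ν) :=
  FreeAlgebra.ι K (.dot ⟨k, hk⟩ s)

/-- `τ_{k,s}` in the free algebra. -/
def ft {ν : I → ℕ} (k : ℕ) (hk : k + 1 < ht ν) (s : Seq ν) : FreeAlgebra K (Gen ν) :=
  FreeAlgebra.ι K (.cross k hk s)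

/-- The defining relations of `R(ν)`. In a product `A * B` the diagram `A` is on top of `B`. -/
inductive Rel (D : BorcherdsCartanDatum I) (ν : I → ℕ) :
    FreeAlgebra K (Gen ν) → FreeAlgebra K (Gen ν) → Prop
  -- concatenation: mismatched diagrams multiply to zero, the `1_s` are identity diagrams
  | idem_self (s : Seq ν) : Rel D ν (fe K s * fe K s) (fe K s)
  | idem_ne (s t : Seq ν) (h : s ≠ t) : Rel D ν (fe K s * fe K t) 0
  | idem_sum : Rel D ν (∑ s : Seq ν, fe K s) 1
  | dot_top (k : ℕ) (hk : k < ht ν) (s : Seq ν) : Rel D ν (fe K s * fx K k hk s) (fx K k hk s)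
  | dot_bot (k : ℕ) (hk : k < ht ν) (s : Seq ν) : Rel D ν (fx K k hk s * fe K s) (fx K k hk s)
  | cross_top (k : ℕ) (hk : k + 1 < ht ν) (s : Seq ν) :
      Rel D ν (fe K (s.swap k hk) * ft K k hk s) (ft K k hk s)
  | cross_bot (k : ℕ) (hk : k + 1 < ht ν) (s : Seq ν) :
      Rel D ν (ft K k hk s * fe K s) (ft K k hk s)
  -- planar isotopy: distant dots and crossings commute
  | dot_dot (k l : ℕ) (hk : k < ht ν) (hl : l < ht ν) (s : Seq ν) :
      Rel D ν (fx K k hk s * fx K l hl s) (fx K l hl s * fx K k hk s)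
  | dot_cross (k l : ℕ) (hk : k + 1 < ht ν) (hl : l < ht ν) (h : l ≠ k) (h' : l ≠ k + 1)
      (s : Seq ν) :
      Rel D ν (fx K l hl (s.swap k hk) * ft K k hk s) (ft K k hk s * fx K l hl s)
  | cross_cross (k l : ℕ) (hk : k + 1 < ht ν) (hl : l + 1 < ht ν) (h : k + 1 < l) (s : Seq ν) :
      Rel D ν (ft K k hk (s.swap l hl) * ft K l hl s) (ft K l hl (s.swap k hk) * ft K k hk s)
  -- double crossings
  | sq_eq (k : ℕ) (hk : k + 1 < ht ν) (s : Seq ν) (i : I)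
      (h₀ : s.1 ⟨k, by omega⟩ = i) (h₁ : s.1 ⟨k + 1, hk⟩ = i) :
      Rel D ν (ft K k hk (s.swap k hk) * ft K k hk s) 0
  | sq_orth (k : ℕ) (hk : k + 1 < ht ν) (s : Seq ν) (i j : I)
      (h₀ : s.1 ⟨k, by omega⟩ = i) (h₁ : s.1 ⟨k + 1, hk⟩ = j)
      (hij : i ≠ j) (hf : D.form i j = 0) :
      Rel D ν (ft K k hk (s.swap k hk) * ft K k hk s) (fe K s)
  | sq_edge (k : ℕ) (hk : k + 1 < ht ν) (s : Seq ν) (i j : I)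
      (h₀ : s.1 ⟨k, by omega⟩ = i) (h₁ : s.1 ⟨k + 1, hk⟩ = j)
      (hij : i ≠ j) (hf : D.form i j ≠ 0) :
      Rel D ν (ft K k hk (s.swap k hk) * ft K k hk s)
        (fx K k (by omega) s ^ (-D.a i j).toNat + fx K (k + 1) hk s ^ (-D.a j i).toNat)
  -- sliding a dot through a crossing of two strands labelled by one `i` with `a i i = 2`
  | slide_real_left (k : ℕ) (hk : k + 1 < ht ν) (s : Seq ν) (i : I)
      (h₀ : s.1 ⟨k, by omega⟩ = i) (h₁ : s.1 ⟨k + 1, hk⟩ = i) (hi : D.a i i = 2) :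
      Rel D ν (fx K k (by omega) (s.swap k hk) * ft K k hk s)
        (ft K k hk s * fx K (k + 1) hk s + fe K s)
  | slide_real_right (k : ℕ) (hk : k + 1 < ht ν) (s : Seq ν) (i : I)
      (h₀ : s.1 ⟨k, by omega⟩ = i) (h₁ : s.1 ⟨k + 1, hk⟩ = i) (hi : D.a i i = 2) :
      Rel D ν (ft K k hk s * fx K k (by omega) s)
        (fx K (k + 1) hk (s.swap k hk) * ft K k hk s + fe K s)
  -- sliding a dot through any other crossing: labels `i ≠ j`, or `i = j` with `a i i ≤ 0`
  | slide_left (k : ℕ) (hk : k + 1 < ht ν) (s : Seq ν) (i j : I)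
      (h₀ : s.1 ⟨k, by omega⟩ = i) (h₁ : s.1 ⟨k + 1, hk⟩ = j) (hij : i ≠ j ∨ D.a i i ≤ 0) :
      Rel D ν (fx K k (by omega) (s.swap k hk) * ft K k hk s) (ft K k hk s * fx K (k + 1) hk s)
  | slide_right (k : ℕ) (hk : k + 1 < ht ν) (s : Seq ν) (i j : I)
      (h₀ : s.1 ⟨k, by omega⟩ = i) (h₁ : s.1 ⟨k + 1, hk⟩ = j) (hij : i ≠ j ∨ D.a i i ≤ 0) :
      Rel D ν (ft K k hk s * fx K k (by omega) s) (fx K (k + 1) hk (s.swap k hk) * ft K k hk s)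
  -- braid relations: labels `i j i` with `a i i = 2`, `i ≠ j`, `i · j ≠ 0`
  | braid_real (k : ℕ) (hk : k + 2 < ht ν) (s : Seq ν) (i j : I)
      (h₀ : s.1 ⟨k, by omega⟩ = i) (h₁ : s.1 ⟨k + 1, by omega⟩ = j) (h₂ : s.1 ⟨k + 2, hk⟩ = i)
      (hi : D.a i i = 2) (hij : i ≠ j) (hf : D.form i j ≠ 0) :
      Rel D ν
        (ft K k (by omega) ((s.swap k (by omega)).swap (k + 1) hk) *
          ft K (k + 1) hk (s.swap k (by omega)) * ft K k (by omega) s)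
        (ft K (k + 1) hk ((s.swap (k + 1) hk).swap k (by omega)) *
          ft K k (by omega) (s.swap (k + 1) hk) * ft K (k + 1) hk s +
          ∑ c ∈ Finset.range (-D.a i j).toNat,
            fx K k (by omega) s ^ c * fx K (k + 2) hk s ^ ((-D.a i j).toNat - 1 - c) * fe K s)
  -- braid relations: all other labels `i j l`
  | braid (k : ℕ) (hk : k + 2 < ht ν) (s : Seq ν) (i j l : I)
      (h₀ : s.1 ⟨k, by omega⟩ = i) (h₁ : s.1 ⟨k + 1, by omega⟩ = j) (h₂ : s.1 ⟨k + 2, hk⟩ = l)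
      (h : ¬ (i = l ∧ D.a i i = 2 ∧ i ≠ j ∧ D.form i j ≠ 0)) :
      Rel D ν
        (ft K k (by omega) ((s.swap k (by omega)).swap (k + 1) hk) *
          ft K (k + 1) hk (s.swap k (by omega)) * ft K k (by omega) s)
        (ft K (k + 1) hk ((s.swap (k + 1) hk).swap k (by omega)) *
          ft K k (by omega) (s.swap (k + 1) hk) * ft K (k + 1) hk s)

/-- The quiver Hecke algebra `R(ν)` of a Borcherds-Cartan datum. -/
abbrev R (D : BorcherdsCartanDatum I) (ν : I → ℕ) : Type _ := RingQuot (Rel K D ν)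

/-- The image in `R(ν)` of an elementary diagram. -/
def gen (D : BorcherdsCartanDatum I) (ν : I → ℕ) (g : Gen ν) : R K D ν :=
  RingQuot.mkAlgHom K (Rel K D ν) (FreeAlgebra.ι K g)

/-- The homogeneous component of degree `d` of `R(ν)`: the span of the products of elementary
diagrams of total degree `d`. -/
def homogeneousPart (D : BorcherdsCartanDatum I) (ν : I → ℕ) (d : ℤ) : Submodule K (R K D ν) :=
  Submodule.span K
    {z | ∃ w : List (Gen ν), (w.map (Gen.deg D)).sum = d ∧ (w.map (gen K D ν)).prod = z}

end

/-- The tensor product over `k` of the algebras `K[z_1, …, z_{m k}]^{S_{m k}}` of symmetric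
polynomials. -/
abbrev SymTensor (K : Type*) [Field K] {t : ℕ} (m : Fin t → ℕ) : Type _ :=
  ⨂[K] k : Fin t, MvPolynomial.symmetricSubalgebra (Fin (m k)) K

/-- The homogeneous component of degree `d` of `SymTensor K m`, when each variable of the `k`-th
factor has degree `w k`. -/
noncomputable def SymTensor.homogeneousPart (K : Type*) [Field K] {t : ℕ} (m : Fin t → ℕ) (w : Fin t → ℤ)
    (d : ℤ) : Submodule K (SymTensor K m) :=
  Submodule.span K
    {z | ∃ (f : ∀ k : Fin t, MvPolynomial.symmetricSubalgebra (Fin (m k)) K) (p : Fin t → ℕ),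
      (∀ k, (f k : MvPolynomial (Fin (m k)) K).IsHomogeneous (p k)) ∧
      ∑ k, w k * (p k : ℤ) = d ∧ PiTensorProduct.tprod K f = z}

end QuiverHecke

set_option linter.unusedSectionVars false

/-! Put n = `ht ν`. Each sequence `c` gives an action `rep` of `R(ν)` on functions from the
symmetric group `S_n` to the field of rational functions in n variables, linear over that field. At
a permutation w, the dot on strand k multiplies by the variable with index w(k), an idempotent tests
the sequence of labels `c.perm w`, and a crossing combines the values at w and at w s_k. The
coefficients are those of a divided difference for two equal real labels. For different labels the
polynomial of the double crossing is carried by one of the two directions, the other having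
coefficient 1. For equal imaginary labels one direction is 1 and the other 0, so that the square
vanishes.

This replaces an explicit basis theorem. Sliding and the braid relations, both up to polynomial
corrections, show that `R(ν)` is spanned by n! elements, one of them 1, as a right module over the
polynomials in the dots and idempotents (`exists_spanning`). The delta function at the identity
generates the n!-dimensional space of the representation, because a crossing has a nonzero
coefficient from w to w s_k whenever w(k) < w(k+1). So the n! elements applied to this delta
function form a basis (`linearIndependent_rep_delta`).

Let z be central. The dots act on the delta functions by pairwise distinct systems of eigenvalues,
so z preserves the line of the delta function at the identity. By independence, only the spanning
element 1 can occur in z, so z is a family of polynomials, one for each sequence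
(`exists_diagonal_of_central`). Commuting with the crossings means exactly that adjacent
transpositions carry the members of the family to one another (`diagonal_central_iff`). For equal
real labels this makes the polynomial symmetric in the two variables, which kills the
divided-difference term.

Such a family is determined by one member, a polynomial invariant under permuting strands with the
same label. Orbit sums identify these invariants with the tensor product of the rings of symmetric
polynomials. For the degrees, the defining relations are homogeneous, so there is a coaction of
`R(ν)` into Laurent polynomials over `R(ν)` that separates degrees. It shows that a family is
homogeneous in `R(ν)` exactly when each of its polynomials is weighted homogeneous. -/

namespace QuiverHecke

/-! ### Coefficients of the generic representation -/

section Representation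

open MvPolynomial Equiv

variable {I : Type*} [DecidableEq I]

/-- A sequence with permuted entries. -/
def Seq.perm [Fintype I] {ν : I → ℕ} (s : Seq ν) (w : Perm (Fin (ht ν))) : Seq ν :=
  ⟨fun p => s.1 (w p), fun i => by
    rw [← s.2 i]
    exact Finset.card_equiv w (by simp)⟩

section

variable [Fintype I] {ν : I → ℕ}

/-- The adjacent transposition of the positions `k` and `k + 1`. -/
abbrev adj (k : ℕ) (hk : k + 1 < ht ν) : Perm (Fin (ht ν)) :=
  Equiv.swap ⟨k, Nat.lt_of_succ_lt hk⟩ ⟨k + 1, hk⟩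

theorem Seq.perm_adj (s : Seq ν) (k : ℕ) (hk : k + 1 < ht ν) :
    s.perm (adj k hk) = s.swap k hk := rfl

theorem Seq.perm_mul (s : Seq ν) (w u : Perm (Fin (ht ν))) :
    s.perm (w * u) = (s.perm w).perm u := rfl

@[simp] theorem Seq.perm_one (s : Seq ν) : s.perm 1 = s := rfl

@[simp] theorem Seq.perm_apply (s : Seq ν) (w : Perm (Fin (ht ν))) (p : Fin (ht ν)) :
    (s.perm w).1 p = s.1 (w p) := rfl

@[simp] theorem Seq.swap_apply (s : Seq ν) (k : ℕ) (hk : k + 1 < ht ν) (p : Fin (ht ν)) :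
    (s.swap k hk).1 p = s.1 (adj k hk p) := rfl

@[simp] theorem Seq.swap_swap (s : Seq ν) (k : ℕ) (hk : k + 1 < ht ν) :
    (s.swap k hk).swap k hk = s := by
  apply Subtype.ext; funext p; simp

end

variable (K : Type*) [Field K]

/-- The field of rational functions in variables `z_0, …, z_{n-1}`. -/
abbrev Rat (n : ℕ) : Type _ := FractionRing (MvPolynomial (Fin n) K)

/-- The variable `z_a` as a rational function. -/
noncomputable def zvar {n : ℕ} (a : Fin n) : Rat K n := algebraMap (MvPolynomial (Fin n) K) _ (X a)

theorem zvar_injective {n : ℕ} : Function.Injective (zvar K (n := n)) :=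
  (IsFractionRing.injective (MvPolynomial (Fin n) K) _).comp (X_injective)

variable (D : BorcherdsCartanDatum I) {n : ℕ} (c : Fin n → I)

/-- The value of a double crossing of strands `a` and `b` with different labels. -/
noncomputable def edge (a b : Fin n) : Rat K n :=
  if D.form (c a) (c b) = 0 then 1
  else zvar K a ^ (-D.a (c a) (c b)).toNat + zvar K b ^ (-D.a (c b) (c a)).toNat

/-- The diagonal coefficient of a crossing of strands `a` and `b`. -/
noncomputable def diagCoeff (a b : Fin n) : Rat K n :=
  if c a = c b ∧ D.a (c a) (c a) = 2 then (zvar K a - zvar K b)⁻¹ else 0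

/-- The off-diagonal coefficient of a crossing of strands `a` and `b`. -/
noncomputable def crossCoeff (a b : Fin n) : Rat K n :=
  if c a = c b then
    if D.a (c a) (c a) = 2 then -(zvar K a - zvar K b)⁻¹ else if b < a then 1 else 0
  else if b < a then 1 else edge K D c a b

variable {K D c} {a b d : Fin n}

theorem form_comm (i j : I) : D.form i j = D.form j i := D.symm i j

theorem form_eq_zero_iff (i j : I) : D.form i j = 0 ↔ D.a i j = 0 := by
  simp [BorcherdsCartanDatum.form, (D.r_pos i).ne']

theorem edge_comm : edge K D c a b = edge K D c b a := by
  unfold edge; rw [form_comm (D := D) (c a), add_comm]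

theorem diagCoeff_real (h : c a = c b) (h' : D.a (c a) (c a) = 2) :
    diagCoeff K D c a b = (zvar K a - zvar K b)⁻¹ := if_pos ⟨h, h'⟩

theorem crossCoeff_real (h : c a = c b) (h' : D.a (c a) (c a) = 2) :
    crossCoeff K D c a b = -(zvar K a - zvar K b)⁻¹ := by simp [crossCoeff, ← h, h']

theorem diagCoeff_eq_zero (h : ¬ (c a = c b ∧ D.a (c a) (c a) = 2)) :
    diagCoeff K D c a b = 0 := if_neg h

theorem diagCoeff_swap : diagCoeff K D c b a = - diagCoeff K D c a b := by
  by_cases h : c a = c b ∧ D.a (c a) (c a) = 2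
  · rw [diagCoeff_real h.1 h.2, diagCoeff_real h.1.symm (h.1 ▸ h.2), ← inv_neg, neg_sub]
  · rw [diagCoeff_eq_zero h, diagCoeff_eq_zero, neg_zero]
    rintro ⟨h1, h2⟩; exact h ⟨h1.symm, h1 ▸ h2⟩

/-- One of the two directions has coefficient 0. This is how a crossing of equal imaginary strands
squares to zero without a divided difference. -/
theorem crossCoeff_mul_imaginary (hab : a ≠ b) (h : c a = c b) (h' : D.a (c a) (c a) ≠ 2) :
    crossCoeff K D c a b * crossCoeff K D c b a = 0 := by
  rcases lt_or_gt_of_ne hab with h1 | h1 <;> simp [crossCoeff, ← h, h', h1, h1.le]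

/-- One direction carries 1 and the other the whole double-crossing value. The asymmetry puts the
invertible coefficient on the length-increasing side. -/
theorem crossCoeff_mul_edge (hab : a ≠ b) (h : c a ≠ c b) :
    crossCoeff K D c a b * crossCoeff K D c b a = edge K D c a b := by
  rcases lt_or_gt_of_ne hab with h1 | h1 <;>
    simp [crossCoeff, h, h.symm, h1, h1.not_gt, edge_comm (a := b)]

/-- This is the direction in which delta functions are reached from the identity. The opposite
coefficient may vanish. -/
theorem crossCoeff_ne_zero (hab : b < a) : crossCoeff K D c a b ≠ 0 := by
  unfold crossCoeff
  have := sub_ne_zero.2 ((zvar_injective K).ne hab.ne')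
  split_ifs <;> simp [this]

/-- The square of a crossing, diagonal part. -/
theorem diagCoeff_sq (hab : a ≠ b) : diagCoeff K D c a b ^ 2 +
    crossCoeff K D c a b * crossCoeff K D c b a = if c a = c b then 0 else edge K D c a b := by
  by_cases h : c a = c b
  · by_cases h' : D.a (c a) (c a) = 2
    · rw [diagCoeff_real h h', crossCoeff_real h h', crossCoeff_real h.symm (h ▸ h'), if_pos h,
        ← neg_sub (zvar K a) (zvar K b), inv_neg]; ring
    · rw [diagCoeff_eq_zero (by simp [h']), crossCoeff_mul_imaginary hab h h', if_pos h]; simp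
  · rw [diagCoeff_eq_zero (by simp [h]), crossCoeff_mul_edge hab h, if_neg h]; simp

/-- The three-term relation between the diagonal coefficients. -/
theorem diagCoeff_three (hab : a ≠ b) (hbd : b ≠ d) (had : a ≠ d) :
    diagCoeff K D c a b * diagCoeff K D c b d =
      diagCoeff K D c a d * (diagCoeff K D c a b + diagCoeff K D c b d) := by
  have h1 := sub_ne_zero.2 ((zvar_injective K).ne hab)
  have h2 := sub_ne_zero.2 ((zvar_injective K).ne hbd)
  have h3 := sub_ne_zero.2 ((zvar_injective K).ne had)
  by_cases h : c a = c b <;> by_cases h' : c b = c d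
  · by_cases hr : D.a (c a) (c a) = 2
    · rw [diagCoeff_real h hr, diagCoeff_real h' (h ▸ hr), diagCoeff_real (h.trans h') hr]
      field_simp
      ring
    · rw [diagCoeff_eq_zero (b := b) (by simp [hr]), diagCoeff_eq_zero (b := d) (by simp [← h, hr])]
      simp
  · rw [diagCoeff_eq_zero (b := d) (by simp [h']),
      diagCoeff_eq_zero (a := a) (b := d) (by simp [h, h'])]; simp
  · rw [diagCoeff_eq_zero (b := b) (by simp [h]),
      diagCoeff_eq_zero (a := a) (b := d) (by simp [← h', h])]; simp
  · rw [diagCoeff_eq_zero (b := b) (by simp [h]), diagCoeff_eq_zero (a := b) (b := d)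
      (by simp [h'])]; simp

end Representation

/-! ### Operators of idempotents, dots and crossings -/

section Representation

open MvPolynomial Equiv

variable {K : Type*} [Field K] {I : Type*} [DecidableEq I]

/-- The diagonal correction in the braid relation. -/
theorem diagCoeff_braid {D : BorcherdsCartanDatum I} {n : ℕ} {c : Fin n → I} {a b d : Fin n}
    (hab : a ≠ b) (hbd : b ≠ d) (had : a ≠ d) :
    diagCoeff K D c a b ^ 2 * diagCoeff K D c b d +
        crossCoeff K D c a b * crossCoeff K D c b a * diagCoeff K D c a d =
      diagCoeff K D c b d ^ 2 * diagCoeff K D c a b +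
        crossCoeff K D c b d * crossCoeff K D c d b * diagCoeff K D c a d +
      if c a = c d ∧ D.a (c a) (c a) = 2 ∧ c a ≠ c b ∧ D.form (c a) (c b) ≠ 0 then
        ∑ e ∈ Finset.range (-D.a (c a) (c b)).toNat,
          zvar K a ^ e * zvar K d ^ ((-D.a (c a) (c b)).toNat - 1 - e)
      else 0 := by
  have h1 := diagCoeff_sq (K := K) (D := D) (c := c) hab
  have h2 := diagCoeff_sq (K := K) (D := D) (c := c) hbd
  have h3 := diagCoeff_three (K := K) (D := D) (c := c) hab hbd had
  suffices h : ((if c a = c b then 0 else edge K D c a b) - (if c b = c d then 0 else edge K D c b d))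
      * diagCoeff K D c a d = if c a = c d ∧ D.a (c a) (c a) = 2 ∧ c a ≠ c b ∧
        D.form (c a) (c b) ≠ 0 then
        ∑ e ∈ Finset.range (-D.a (c a) (c b)).toNat,
          zvar K a ^ e * zvar K d ^ ((-D.a (c a) (c b)).toNat - 1 - e)
      else 0 by
    rw [← h, ← h1, ← h2]
    -- Once the squares are expanded, the difference of the two sides factors through the difference
    -- of the two diagonal coefficients. What is left is the three-term relation.
    linear_combination (diagCoeff K D c a b - diagCoeff K D c b d) * h3
  by_cases h : c a = c d ∧ D.a (c a) (c a) = 2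
  · rw [diagCoeff_real h.1 h.2]
    by_cases h' : c a = c b
    · simp [h', ← h.1]
    · by_cases hf : D.form (c a) (c b) = 0
      · simp [h', ← h.1, edge, hf, form_comm (D := D) (c b), Ne.symm h']
      · have hz := sub_ne_zero.2 ((zvar_injective K).ne had)
        simp only [h', ← h.1, edge, hf, form_comm (D := D) (c b), Ne.symm h', h.2, if_false, true_and,
          ne_eq, not_false_eq_true, if_true]
        -- The middle variable cancels between the two edge polynomials, leaving a difference of
        -- equal powers of the outer variables; the sum is its geometric quotient.
        rw [← div_eq_mul_inv, div_eq_iff hz, Commute.geom_sum₂_mul (Commute.all _ _)]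
        ring
  · rw [diagCoeff_eq_zero h, mul_zero, if_neg]
    exact fun h' => h ⟨h'.1, h'.2.1⟩

variable [Fintype I] {ν : I → ℕ} (K) (D : BorcherdsCartanDatum I) (c : Seq ν)

/-- The space on which `R(ν)` is represented. -/
abbrev RepSpace (ν : I → ℕ) : Type _ := Perm (Fin (ht ν)) → Rat K (ht ν)

/-- The action of an idempotent. -/
noncomputable def opE (s : Seq ν) : Module.End (Rat K (ht ν)) (RepSpace K ν) where
  toFun φ w := if c.perm w = s then φ w else 0
  map_add' φ ψ := by funext w; simp only [Pi.add_apply]; split_ifs <;> simp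
  map_smul' r φ := by funext w; simp

/-- The action of a dot. -/
noncomputable def opX (k : Fin (ht ν)) : Module.End (Rat K (ht ν)) (RepSpace K ν) where
  toFun φ w := zvar K (w k) * φ w
  map_add' φ ψ := by funext w; simp [mul_add]
  map_smul' r φ := by funext w; simp [mul_left_comm]

/-- The action of a crossing. -/
noncomputable def opT (k : ℕ) (hk : k + 1 < ht ν) :
    Module.End (Rat K (ht ν)) (RepSpace K ν) where
  toFun φ w :=
    diagCoeff K D c.1 (w ⟨k, Nat.lt_of_succ_lt hk⟩) (w ⟨k + 1, hk⟩) * φ w +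
    crossCoeff K D c.1 (w ⟨k, Nat.lt_of_succ_lt hk⟩) (w ⟨k + 1, hk⟩) * φ (w * adj k hk)
  map_add' φ ψ := by funext w; simp only [Pi.add_apply]; ring
  map_smul' r φ := by funext w; simp only [Pi.smul_apply, smul_eq_mul, RingHom.id_apply]; ring

variable {K D c}

theorem opE_apply (s : Seq ν) (φ : RepSpace K ν) (w : Perm (Fin (ht ν))) :
    opE K c s φ w = if c.perm w = s then φ w else 0 := rfl

theorem opX_apply (k : Fin (ht ν)) (φ : RepSpace K ν) (w : Perm (Fin (ht ν))) :
    opX K k φ w = zvar K (w k) * φ w := rfl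

theorem opT_apply (k : ℕ) (hk : k + 1 < ht ν) (φ : RepSpace K ν) (w : Perm (Fin (ht ν))) :
    opT K D c k hk φ w =
    diagCoeff K D c.1 (w ⟨k, Nat.lt_of_succ_lt hk⟩) (w ⟨k + 1, hk⟩) * φ w +
    crossCoeff K D c.1 (w ⟨k, Nat.lt_of_succ_lt hk⟩) (w ⟨k + 1, hk⟩) * φ (w * adj k hk) := rfl

theorem opE_mul_opE_self (s : Seq ν) : opE K c s * opE K c s = opE K c s := by
  refine LinearMap.ext fun φ => funext fun w => ?_
  simp only [Module.End.mul_apply, opE_apply]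
  split_ifs <;> rfl

theorem opE_mul_opE_ne {s t : Seq ν} (h : s ≠ t) : opE K c s * opE K c t = 0 := by
  refine LinearMap.ext fun φ => funext fun w => ?_
  simp only [Module.End.mul_apply, opE_apply]
  split_ifs with h1 h2
  · exact (h (h1.symm.trans h2)).elim
  all_goals rfl

theorem opX_mul_opE (k : Fin (ht ν)) (s : Seq ν) : opX K k * opE K c s = opE K c s * opX K k := by
  refine LinearMap.ext fun φ => funext fun w => ?_
  simp [opX_apply, opE_apply]

theorem opX_mul_opX (k l : Fin (ht ν)) : opX K k * opX K l = opX K l * opX K k := by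
  refine LinearMap.ext fun φ => funext fun w => ?_
  simp [opX_apply, mul_left_comm]

/-- The part of a crossing that stays at w is nonzero only if the two labels agree, and then
exchanging them does not change the sequence. -/
theorem opT_mul_opE (k : ℕ) (hk : k + 1 < ht ν) (s : Seq ν) :
    opT K D c k hk * opE K c s = opE K c (s.swap k hk) * opT K D c k hk := by
  refine LinearMap.ext fun φ => funext fun w => ?_
  simp only [Module.End.mul_apply, opE_apply, opT_apply]
  have h2 : c.perm (w * adj k hk) = s ↔ c.perm w = s.swap k hk := by
    rw [Seq.perm_mul, Seq.perm_adj]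
    constructor
    · rintro rfl; simp
    · rintro h; simp [h]
  rw [if_congr h2 rfl rfl]
  by_cases h : c.1 (w ⟨k, Nat.lt_of_succ_lt hk⟩) = c.1 (w ⟨k + 1, hk⟩)
  · have h3 : (c.perm w).swap k hk = c.perm w := by
      apply Subtype.ext; funext p
      simp only [Seq.swap_apply, Seq.perm_apply]
      rw [Equiv.swap_apply_def]
      split_ifs with h4 h5
      · rw [h4, h]
      · rw [h5, h]
      · rfl
    have h4 : c.perm w = s ↔ c.perm w = s.swap k hk := by
      constructor
      · rintro rfl; exact h3.symm
      · intro h; rw [← h3, h]; simp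
    rw [if_congr h4 rfl rfl]
    split_ifs <;> simp
  · rw [diagCoeff_eq_zero (fun h' => h h'.1)]
    split_ifs <;> simp

/-- Two operators agree after projecting to a sequence if they agree there. -/
theorem opE_mul_congr {s : Seq ν} {A B : Module.End (Rat K (ht ν)) (RepSpace K ν)}
    (h : ∀ φ w, c.perm w = s → A φ w = B φ w) : opE K c s * A = opE K c s * B := by
  refine LinearMap.ext fun φ => funext fun w => ?_
  simp only [Module.End.mul_apply, opE_apply]
  split_ifs with h'
  · exact h φ w h'
  · rfl

theorem opT_opT_apply (k : ℕ) (hk : k + 1 < ht ν) (φ : RepSpace K ν) (w : Perm (Fin (ht ν))) :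
    opT K D c k hk (opT K D c k hk φ) w =
      if c.1 (w ⟨k, Nat.lt_of_succ_lt hk⟩) = c.1 (w ⟨k + 1, hk⟩) then 0
      else edge K D c.1 (w ⟨k, Nat.lt_of_succ_lt hk⟩) (w ⟨k + 1, hk⟩) * φ w := by
  have h := diagCoeff_sq (K := K) (D := D) (c := c.1) (a := w ⟨k, Nat.lt_of_succ_lt hk⟩)
    (b := w ⟨k + 1, hk⟩) (by simp)
  simp only [opT_apply, Perm.mul_apply, swap_apply_left, swap_apply_right, mul_assoc, swap_mul_self,
    mul_one]
  -- Antisymmetry of the diagonal coefficient cancels the two contributions of the value at w s_k.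
  rw [diagCoeff_swap (a := w ⟨k, Nat.lt_of_succ_lt hk⟩)]
  split_ifs at h ⊢ with h1
  · linear_combination h * φ w
  · linear_combination h * φ w

theorem adj_comm {k l : ℕ} (hk : k + 1 < ht ν) (hl : l + 1 < ht ν) (h : k + 1 < l) :
    adj k hk * adj l hl = adj l hl * adj k hk := by
  refine (Equiv.Perm.disjoint_iff_disjoint_support.2 ?_).commute
  rw [Equiv.Perm.support_swap (by simp), Equiv.Perm.support_swap (by simp)]
  simp [Fin.ext_iff]; omega

theorem adj_braid_eq_swap {k : ℕ} (hk : k + 2 < ht ν) :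
    adj k (by omega) * (adj (k + 1) hk * adj k (by omega)) =
      Equiv.swap ⟨k, by omega⟩ ⟨k + 2, hk⟩ := by
  have h2 := Equiv.swap_mul_swap_mul_swap (x := (⟨k + 2, by omega⟩ : Fin (ht ν)))
    (y := ⟨k + 1, by omega⟩) (z := ⟨k, by omega⟩) (by simp) (by simp)
  have e4 : swap (⟨k + 1, by omega⟩ : Fin (ht ν)) ⟨k, by omega⟩ = adj k (by omega) :=
    swap_comm _ _
  have e5 : swap (⟨k + 2, by omega⟩ : Fin (ht ν)) ⟨k + 1, by omega⟩ = adj (k + 1) hk :=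
    swap_comm _ _
  rw [e4, e5, mul_assoc] at h2
  exact h2

theorem adj_braid {k : ℕ} (hk : k + 2 < ht ν) :
    adj k (by omega) * (adj (k + 1) hk * adj k (by omega)) =
      adj (k + 1) hk * (adj k (by omega) * adj (k + 1) hk) := by
  have h1 := Equiv.swap_mul_swap_mul_swap (x := (⟨k, by omega⟩ : Fin (ht ν)))
    (y := ⟨k + 1, by omega⟩) (z := ⟨k + 2, hk⟩) (by simp) (by simp)
  rw [adj_braid_eq_swap hk, swap_comm, ← h1, mul_assoc]

theorem adj_braid_apply {k : ℕ} (hk : k + 2 < ht ν) (p : Fin (ht ν)) :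
    adj k (by omega) (adj (k + 1) hk (adj k (by omega) p)) =
      Equiv.swap ⟨k, by omega⟩ ⟨k + 2, hk⟩ p := by
  rw [← adj_braid_eq_swap hk]; rfl

theorem opT_opT_comm (k l : ℕ) (hk : k + 1 < ht ν) (hl : l + 1 < ht ν) (h : k + 1 < l) :
    opT K D c k hk * opT K D c l hl = opT K D c l hl * opT K D c k hk := by
  refine LinearMap.ext fun φ => funext fun w => ?_
  have h1 := adj_comm hk hl h
  have e1 : adj k hk ⟨l, by omega⟩ = ⟨l, by omega⟩ :=
    swap_apply_of_ne_of_ne (by simp; omega) (by simp; omega)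
  have e2 : adj k hk ⟨l + 1, by omega⟩ = ⟨l + 1, by omega⟩ :=
    swap_apply_of_ne_of_ne (by simp; omega) (by simp; omega)
  have e3 : adj l hl ⟨k, by omega⟩ = ⟨k, by omega⟩ :=
    swap_apply_of_ne_of_ne (by simp; omega) (by simp; omega)
  have e4 : adj l hl ⟨k + 1, by omega⟩ = ⟨k + 1, by omega⟩ :=
    swap_apply_of_ne_of_ne (by simp; omega) (by simp; omega)
  simp only [opT_apply, Module.End.mul_apply, Perm.mul_apply, e1, e2, e3, e4, mul_assoc, h1]
  ring

theorem opT_braid_apply (k : ℕ) (hk : k + 2 < ht ν) (φ : RepSpace K ν) (w : Perm (Fin (ht ν)))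
    {a b d : Fin (ht ν)} (ha : w ⟨k, by omega⟩ = a) (hb : w ⟨k + 1, by omega⟩ = b)
    (hd : w ⟨k + 2, hk⟩ = d) :
    opT K D c k (by omega) (opT K D c (k + 1) hk (opT K D c k (by omega) φ)) w =
      opT K D c (k + 1) hk (opT K D c k (by omega) (opT K D c (k + 1) hk φ)) w +
      (if c.1 a = c.1 d ∧ D.a (c.1 a) (c.1 a) = 2 ∧ c.1 a ≠ c.1 b ∧ D.form (c.1 a) (c.1 b) ≠ 0 then
        ∑ e ∈ Finset.range (-D.a (c.1 a) (c.1 b)).toNat,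
          zvar K a ^ e * zvar K d ^ ((-D.a (c.1 a) (c.1 b)).toNat - 1 - e)
      else 0) * φ w := by
  have hab : a ≠ b := by rw [← ha, ← hb]; simp
  have hbd : b ≠ d := by rw [← hb, ← hd]; simp
  have had : a ≠ d := by rw [← ha, ← hd]; simp
  have e1 : adj k (by omega) ⟨k + 1 + 1, by omega⟩ = ⟨k + 2, hk⟩ :=
    swap_apply_of_ne_of_ne (by simp; omega) (by simp)
  have e2 : adj (k + 1) (by omega) ⟨k, by omega⟩ = ⟨k, by omega⟩ :=
    swap_apply_of_ne_of_ne (by simp) (by simp; omega)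
  have e3 : adj (k + 1) hk ⟨k + 2, by omega⟩ = ⟨k + 1, by omega⟩ := swap_apply_right _ _
  have hbr := adj_braid hk
  have h0 := diagCoeff_braid (K := K) (D := D) (c := c.1) hab hbd had
  have h1 := diagCoeff_three (K := K) (D := D) (c := c.1) hab hbd had
  simp only [opT_apply, Perm.mul_apply, swap_apply_left, swap_apply_right, e1, e2, e3, ha, hb, hd,
    mul_assoc, hbr, swap_mul_self, mul_one]
  rw [diagCoeff_swap (a := a) (b := b), diagCoeff_swap (a := b) (b := d)]
  -- Only the values at w, w s_k and w s_{k+1} need an identity. The coefficients at the three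
  -- longer products agree on both sides.
  linear_combination h0 * φ w + crossCoeff K D c.1 a b * φ (w * adj k (by omega)) * h1
    - crossCoeff K D c.1 b d * φ (w * adj (k + 1) hk) * h1

end Representation

/-! ### Verification of the defining relations -/

section Representation

open MvPolynomial Equiv

variable {K : Type*} [Field K] {I : Type*} [DecidableEq I] [Fintype I] {ν : I → ℕ}
  {D : BorcherdsCartanDatum I} {c : Seq ν}

theorem opE_sum : ∑ s : Seq ν, opE K c s = 1 := by
  refine LinearMap.ext fun φ => funext fun w => ?_
  rw [LinearMap.sum_apply, Finset.sum_apply]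
  simp [opE_apply]

theorem opX_mul_opT_of_ne (k : ℕ) (hk : k + 1 < ht ν) (l : Fin (ht ν)) (h : l.1 ≠ k)
    (h' : l.1 ≠ k + 1) : opX K l * opT K D c k hk = opT K D c k hk * opX K l := by
  refine LinearMap.ext fun φ => funext fun w => ?_
  have e : adj k hk l = l :=
    swap_apply_of_ne_of_ne (by simpa [Fin.ext_iff] using h) (by simpa [Fin.ext_iff] using h')
  simp only [opX_apply, opT_apply, Module.End.mul_apply, Perm.mul_apply, e]
  ring

theorem opT_mul_opT_mul_opE (k : ℕ) (hk : k + 1 < ht ν) (s : Seq ν) :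
    opT K D c k hk * opE K c (s.swap k hk) * (opT K D c k hk * opE K c s) =
      opE K c s * (opT K D c k hk * opT K D c k hk) := by
  rw [opT_mul_opE, opT_mul_opE, Seq.swap_swap, mul_assoc, ← mul_assoc _ (opE K c (s.swap k hk)),
    opT_mul_opE, Seq.swap_swap, ← mul_assoc, ← mul_assoc, ← mul_assoc, opE_mul_opE_self, mul_assoc]

theorem opX_left_apply (k : ℕ) (hk : k + 1 < ht ν) (φ : RepSpace K ν) (w : Perm (Fin (ht ν))) :
    opX K ⟨k, by omega⟩ (opT K D c k hk φ) w = opT K D c k hk (opX K ⟨k + 1, hk⟩ φ) w +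
      if c.1 (w ⟨k, by omega⟩) = c.1 (w ⟨k + 1, hk⟩) ∧
        D.a (c.1 (w ⟨k, by omega⟩)) (c.1 (w ⟨k, by omega⟩)) = 2 then φ w else 0 := by
  simp only [opX_apply, opT_apply, Perm.mul_apply, swap_apply_right]
  split_ifs with h
  · have hz := sub_ne_zero.2 ((zvar_injective K).ne (show w ⟨k, by omega⟩ ≠ w ⟨k + 1, hk⟩ by simp))
    rw [diagCoeff_real h.1 h.2]
    field_simp
    ring
  · rw [diagCoeff_eq_zero h]; ring

theorem opX_right_apply (k : ℕ) (hk : k + 1 < ht ν) (φ : RepSpace K ν) (w : Perm (Fin (ht ν))) :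
    opT K D c k hk (opX K ⟨k, by omega⟩ φ) w = opX K ⟨k + 1, hk⟩ (opT K D c k hk φ) w +
      if c.1 (w ⟨k, by omega⟩) = c.1 (w ⟨k + 1, hk⟩) ∧
        D.a (c.1 (w ⟨k, by omega⟩)) (c.1 (w ⟨k, by omega⟩)) = 2 then φ w else 0 := by
  simp only [opX_apply, opT_apply, Perm.mul_apply, swap_apply_left]
  split_ifs with h
  · have hz := sub_ne_zero.2 ((zvar_injective K).ne (show w ⟨k, by omega⟩ ≠ w ⟨k + 1, hk⟩ by simp))
    rw [diagCoeff_real h.1 h.2]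
    field_simp
    ring
  · rw [diagCoeff_eq_zero h]; ring

theorem opX_pow_apply (k : Fin (ht ν)) (N : ℕ) (φ : RepSpace K ν) (w : Perm (Fin (ht ν))) :
    (opX K k ^ N) φ w = zvar K (w k) ^ N * φ w := by
  induction N generalizing φ with
  | zero => simp
  | succ N ih => rw [pow_succ, Module.End.mul_apply, ih, opX_apply, pow_succ, mul_assoc]

theorem commute_opX_opE (k : Fin (ht ν)) (s : Seq ν) : Commute (opX K k) (opE K c s) :=
  opX_mul_opE k s

theorem opE_pow {N : ℕ} (hN : N ≠ 0) (s : Seq ν) : opE K c s ^ N = opE K c s :=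
  (show IsIdempotentElem (opE K c s) from opE_mul_opE_self s).pow_eq hN

theorem opX_mul_opE_pow {N : ℕ} (hN : N ≠ 0) (k : Fin (ht ν)) (s : Seq ν) :
    (opX K k * opE K c s) ^ N = opE K c s * opX K k ^ N := by
  rw [(commute_opX_opE k s).mul_pow, opE_pow hN, ((commute_opX_opE k s).pow_left N).eq]

theorem opX_mul_opE_pow_mul (N : ℕ) (k : Fin (ht ν)) (s : Seq ν) :
    (opX K k * opE K c s) ^ N * opE K c s = opE K c s * opX K k ^ N := by
  rw [(commute_opX_opE k s).mul_pow, mul_assoc, ← pow_succ, opE_pow N.succ_ne_zero,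
    ((commute_opX_opE k s).pow_left N).eq]

variable (K D c)

/-- The action of an elementary diagram. -/
noncomputable def genAct : Gen ν → Module.End (Rat K (ht ν)) (RepSpace K ν)
  | .idem s => opE K c s
  | .dot k s => opX K k * opE K c s
  | .cross k hk s => opT K D c k hk * opE K c s

/-- The action of the free algebra. -/
noncomputable def freeAct : FreeAlgebra K (Gen ν) →ₐ[K] Module.End (Rat K (ht ν)) (RepSpace K ν) :=
  FreeAlgebra.lift K (genAct K D c)

variable {K D c}

theorem freeAct_fe (s : Seq ν) : freeAct K D c (fe K s) = opE K c s := by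
  simp [freeAct, fe, genAct]

theorem freeAct_fx (k : ℕ) (hk : k < ht ν) (s : Seq ν) :
    freeAct K D c (fx K k hk s) = opX K ⟨k, hk⟩ * opE K c s := by
  simp [freeAct, fx, genAct]

theorem freeAct_ft (k : ℕ) (hk : k + 1 < ht ν) (s : Seq ν) :
    freeAct K D c (ft K k hk s) = opT K D c k hk * opE K c s := by
  simp [freeAct, ft, genAct]

theorem opT_mul_opE_mul (k : ℕ) (hk : k + 1 < ht ν) (s : Seq ν)
    (A : Module.End (Rat K (ht ν)) (RepSpace K ν)) :
    opT K D c k hk * (opE K c s * A) = opE K c (s.swap k hk) * (opT K D c k hk * A) := by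
  rw [← mul_assoc, opT_mul_opE, mul_assoc]

theorem opX_mul_opE_mul (k : Fin (ht ν)) (s : Seq ν)
    (A : Module.End (Rat K (ht ν)) (RepSpace K ν)) :
    opX K k * (opE K c s * A) = opE K c s * (opX K k * A) := by
  rw [← mul_assoc, opX_mul_opE, mul_assoc]

theorem opE_mul_opE_mul (s : Seq ν) (A : Module.End (Rat K (ht ν)) (RepSpace K ν)) :
    opE K c s * (opE K c s * A) = opE K c s * A := by
  rw [← mul_assoc, opE_mul_opE_self]

theorem Seq.swap_eq_self {s : Seq ν} {k : ℕ} {hk : k + 1 < ht ν}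
    (h : s.1 ⟨k, by omega⟩ = s.1 ⟨k + 1, hk⟩) : s.swap k hk = s := by
  apply Subtype.ext; funext p
  rw [Seq.swap_apply, Equiv.swap_apply_def]
  split_ifs with h1 h2
  · rw [h1, h]
  · rw [h2, h]
  · rfl

theorem Seq.swap_comm (s : Seq ν) {k l : ℕ} (hk : k + 1 < ht ν) (hl : l + 1 < ht ν)
    (h : k + 1 < l) : (s.swap k hk).swap l hl = (s.swap l hl).swap k hk := by
  rw [← Seq.perm_adj, ← Seq.perm_adj, ← Seq.perm_adj, ← Seq.perm_adj, ← Seq.perm_mul,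
    ← Seq.perm_mul, adj_comm hk hl h]

theorem Seq.swap_braid (s : Seq ν) {k : ℕ} (hk : k + 2 < ht ν) :
    ((s.swap k (by omega)).swap (k + 1) hk).swap k (by omega) =
      ((s.swap (k + 1) hk).swap k (by omega)).swap (k + 1) hk := by
  simp only [← Seq.perm_adj, ← Seq.perm_mul, mul_assoc, adj_braid]

/-- All idempotents are moved to the far left of a product, where they merge into one. The relation
then has to hold only at permutations w that produce this one sequence, where it is an identity
between coefficients. -/
theorem freeAct_rel ⦃x y : FreeAlgebra K (Gen ν)⦄ (h : Rel K D ν x y) :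
    freeAct K D c x = freeAct K D c y := by
  induction h with
  | idem_self s => simp only [map_mul, freeAct_fe, opE_mul_opE_self]
  | idem_ne s t h => simp only [map_mul, freeAct_fe, map_zero, opE_mul_opE_ne h]
  | idem_sum => simp only [map_sum, freeAct_fe, map_one, opE_sum]
  | dot_top k hk s =>
    simp only [map_mul, freeAct_fe, freeAct_fx, opX_mul_opE]
    rw [← mul_assoc, opE_mul_opE_self]
  | dot_bot k hk s =>
    simp only [map_mul, freeAct_fe, freeAct_fx]
    rw [mul_assoc, opE_mul_opE_self]
  | cross_top k hk s =>
    simp only [map_mul, freeAct_fe, freeAct_ft, opT_mul_opE]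
    rw [← mul_assoc, opE_mul_opE_self]
  | cross_bot k hk s =>
    simp only [map_mul, freeAct_fe, freeAct_ft]
    rw [mul_assoc, opE_mul_opE_self]
  | dot_dot k l hk hl s =>
    simp only [map_mul, freeAct_fx, mul_assoc, opX_mul_opE, opX_mul_opE_mul, opE_mul_opE_mul]
    rw [opX_mul_opX]
  | dot_cross k l hk hl h h' s =>
    simp only [map_mul, freeAct_fx, freeAct_ft, mul_assoc, opX_mul_opE, opX_mul_opE_mul,
      opT_mul_opE, opT_mul_opE_mul, opE_mul_opE_mul]
    rw [opX_mul_opT_of_ne _ _ _ h h']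
  | cross_cross k l hk hl h s =>
    simp only [map_mul, freeAct_ft, mul_assoc, opT_mul_opE, opT_mul_opE_mul, opE_mul_opE_mul]
    rw [opT_opT_comm _ _ _ _ h, Seq.swap_comm s hk hl h]
  | sq_eq k hk s i h₀ h₁ =>
    simp only [map_mul, freeAct_ft, map_zero]
    rw [opT_mul_opT_mul_opE, ← mul_zero (opE K c s)]
    refine opE_mul_congr fun φ w hw => ?_
    subst hw
    simp only [Seq.perm_apply] at h₀ h₁
    rw [Module.End.mul_apply, opT_opT_apply, if_pos (h₀.trans h₁.symm)]
    rfl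
  | sq_orth k hk s i j h₀ h₁ hij hf =>
    simp only [map_mul, freeAct_ft, freeAct_fe]
    rw [opT_mul_opT_mul_opE]
    conv_rhs => rw [← mul_one (opE K c s)]
    refine opE_mul_congr fun φ w hw => ?_
    subst hw h₀ h₁
    simp only [Seq.perm_apply] at hf hij
    rw [Module.End.mul_apply, opT_opT_apply, if_neg hij, edge]
    simp [hf]
  | sq_edge k hk s i j h₀ h₁ hij hf =>
    simp only [map_mul, map_add, map_pow, freeAct_ft, freeAct_fx]
    -- The exponent must be positive: the power 0 of a dot with its idempotent is 1, not the
    -- idempotent.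
    have h1 : (-D.a i j).toNat ≠ 0 := by
      have := D.off_diag i j hij
      have := (form_eq_zero_iff (D := D) i j).not.1 hf
      omega
    have h2 : (-D.a j i).toNat ≠ 0 := by
      have := D.off_diag j i hij.symm
      have := (form_eq_zero_iff (D := D) j i).not.1 (form_comm (D := D) i j ▸ hf)
      omega
    rw [opT_mul_opT_mul_opE, opX_mul_opE_pow h1, opX_mul_opE_pow h2, ← mul_add]
    refine opE_mul_congr fun φ w hw => ?_
    subst hw h₀ h₁
    simp only [Seq.perm_apply] at hf hij ⊢
    rw [Module.End.mul_apply, opT_opT_apply, if_neg hij, edge, LinearMap.add_apply, Pi.add_apply,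
      opX_pow_apply, opX_pow_apply]
    rw [if_neg hf, add_mul]
  | slide_real_left k hk s i h₀ h₁ hi =>
    simp only [map_mul, map_add, freeAct_fx, freeAct_ft, freeAct_fe, mul_assoc, opX_mul_opE,
      opX_mul_opE_mul, opT_mul_opE, opT_mul_opE_mul, opE_mul_opE_mul,
      Seq.swap_eq_self (h₀.trans h₁.symm)]
    conv_rhs => rw [← mul_one (opE K c s), mul_assoc, one_mul, ← mul_add]
    refine opE_mul_congr fun φ w hw => ?_
    subst hw h₀
    simp only [Seq.perm_apply] at h₁ hi
    rw [Module.End.mul_apply, opX_left_apply, if_pos ⟨h₁.symm, hi⟩]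
    rfl
  | slide_real_right k hk s i h₀ h₁ hi =>
    simp only [map_mul, map_add, freeAct_fx, freeAct_ft, freeAct_fe, mul_assoc, opX_mul_opE,
      opX_mul_opE_mul, opT_mul_opE, opT_mul_opE_mul, opE_mul_opE_mul,
      Seq.swap_eq_self (h₀.trans h₁.symm)]
    conv_rhs => rw [← mul_one (opE K c s), mul_assoc, one_mul, ← mul_add]
    refine opE_mul_congr fun φ w hw => ?_
    subst hw h₀
    simp only [Seq.perm_apply] at h₁ hi
    rw [Module.End.mul_apply, opX_right_apply, if_pos ⟨h₁.symm, hi⟩]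
    rfl
  | slide_left k hk s i j h₀ h₁ hij =>
    simp only [map_mul, freeAct_fx, freeAct_ft, mul_assoc, opX_mul_opE,
      opX_mul_opE_mul, opT_mul_opE, opT_mul_opE_mul, opE_mul_opE_mul]
    refine opE_mul_congr fun φ w hw => ?_
    -- The merged idempotent belongs to the top of the crossing, so the labels seen at w are those
    -- of `s` exchanged.
    have hs : s = (c.perm w).swap k hk := by rw [hw, Seq.swap_swap]
    subst hs h₀ h₁
    simp only [Seq.swap_apply, Seq.perm_apply, swap_apply_left, swap_apply_right] at hij
    rw [Module.End.mul_apply, opX_left_apply, if_neg, add_zero]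
    · rfl
    · rintro ⟨h1, h2⟩
      rw [← h1, h2] at hij
      simp at hij
  | slide_right k hk s i j h₀ h₁ hij =>
    simp only [map_mul, freeAct_fx, freeAct_ft, mul_assoc, opX_mul_opE,
      opX_mul_opE_mul, opT_mul_opE, opT_mul_opE_mul, opE_mul_opE_mul]
    refine opE_mul_congr fun φ w hw => ?_
    have hs : s = (c.perm w).swap k hk := by rw [hw, Seq.swap_swap]
    subst hs h₀ h₁
    simp only [Seq.swap_apply, Seq.perm_apply, swap_apply_left, swap_apply_right] at hij
    rw [Module.End.mul_apply, opX_right_apply, if_neg, add_zero]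
    · rfl
    · rintro ⟨h1, h2⟩
      rw [← h1, h2] at hij
      simp at hij
  | braid_real k hk s i j h₀ h₁ h₂ hi hij hf =>
    -- The full twist of three strands reverses their labels, and i j i is its own reversal.
    have hsw : ((s.swap k (by omega)).swap (k + 1) hk).swap k (by omega) = s := by
      apply Subtype.ext; funext p
      simp only [Seq.swap_apply]
      rw [adj_braid_apply hk, Equiv.swap_apply_def]
      split_ifs with h1 h2
      · rw [h1, h₂, h₀]
      · rw [h2, h₂, h₀]
      · rfl
    have hsum : freeAct K D c (∑ e ∈ Finset.range (-D.a i j).toNat,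
        fx K k (by omega) s ^ e * fx K (k + 2) hk s ^ ((-D.a i j).toNat - 1 - e) * fe K s) =
        opE K c s * ∑ e ∈ Finset.range (-D.a i j).toNat,
          opX K ⟨k, by omega⟩ ^ e * opX K ⟨k + 2, hk⟩ ^ ((-D.a i j).toNat - 1 - e) := by
      rw [map_sum, Finset.mul_sum]
      refine Finset.sum_congr rfl fun e _ => ?_
      rw [map_mul, map_mul, map_pow, map_pow, freeAct_fx, freeAct_fx, freeAct_fe, mul_assoc,
        opX_mul_opE_pow_mul, ← mul_assoc, opX_mul_opE_pow_mul, mul_assoc]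
    rw [map_add, hsum]
    simp only [map_mul, freeAct_ft, mul_assoc, opT_mul_opE, opT_mul_opE_mul, opE_mul_opE_mul,
      ← Seq.swap_braid s hk, hsw]
    rw [← mul_add]
    refine opE_mul_congr fun φ w hw => ?_
    subst hw h₀ h₁
    simp only [Seq.perm_apply] at hi hij hf h₂ ⊢
    simp only [Module.End.mul_apply, LinearMap.add_apply, Pi.add_apply, LinearMap.sum_apply,
      Finset.sum_apply, opX_pow_apply]
    rw [opT_braid_apply k hk φ w rfl rfl rfl, if_pos ⟨h₂.symm, hi, hij, hf⟩, Finset.sum_mul]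
    simp only [mul_assoc]
  | braid k hk s i j l h₀ h₁ h₂ h =>
    simp only [map_mul, freeAct_ft, mul_assoc, opT_mul_opE, opT_mul_opE_mul, opE_mul_opE_mul,
      ← Seq.swap_braid s hk]
    refine opE_mul_congr fun φ w hw => ?_
    -- At w the three labels are read in reverse order. The exceptional condition is unaffected,
    -- since it requires the outer labels to be equal.
    have e := fun p => congrArg (fun t : Seq ν => t.1 p) hw
    simp only [Seq.swap_apply, Seq.perm_apply, adj_braid_apply hk] at e
    simp only [Module.End.mul_apply]
    rw [opT_braid_apply k hk φ w rfl rfl rfl, if_neg, zero_mul, add_zero]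
    have e0 := e ⟨k, by omega⟩
    have e1 := e ⟨k + 1, by omega⟩
    have e2 := e ⟨k + 2, by omega⟩
    rw [swap_apply_left, h₂] at e0
    rw [swap_apply_right, h₀] at e2
    rw [swap_apply_of_ne_of_ne (by simp) (by simp), h₁] at e1
    rw [e0, e1, e2]
    rintro ⟨rfl, h3, h4, h5⟩
    exact h ⟨rfl, h3, h4, h5⟩

variable (K D c)

/-- The representation of `R(ν)` attached to the sequence `c`. -/
noncomputable def rep : R K D ν →ₐ[K] Module.End (Rat K (ht ν)) (RepSpace K ν) :=
  RingQuot.liftAlgHom K ⟨freeAct K D c, freeAct_rel⟩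

theorem rep_gen (g : Gen ν) : rep K D c (gen K D ν g) = genAct K D c g := by
  rw [rep, gen, RingQuot.liftAlgHom_mkAlgHom_apply]
  simp [freeAct]

end Representation

/-! ### Spanning over a subalgebra by products of runs -/

section Spanning

variable {K A : Type*} [CommSemiring K] [Semiring A] [Algebra K A]

/-- `τ (m + 1 - d) * ⋯ * τ (m - 1) * τ m`. -/
def run (τ : ℕ → A) (m : ℕ) : ℕ → A
  | 0 => 1
  | d + 1 => τ (m - d) * run τ m d

/-- The sum of the subspaces `run τ m e * B` for `e ≤ d`. -/
def runSpan (τ : ℕ → A) (m : ℕ) (B : Submodule K A) (d : ℕ) : Submodule K A :=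
  Submodule.span K {x | ∃ e ≤ d, ∃ b ∈ B, run τ m e * b = x}

variable {τ : ℕ → A} {m : ℕ} {B : Submodule K A}

theorem run_mul_mem {d e : ℕ} (h : e ≤ d) {b : A} (hb : b ∈ B) :
    run τ m e * b ∈ runSpan τ m B d :=
  Submodule.subset_span ⟨e, h, b, hb, rfl⟩

theorem runSpan_mono {d d' : ℕ} (h : d ≤ d') : runSpan τ m B d ≤ runSpan τ m B d' :=
  Submodule.span_mono fun _ ⟨e, he, hb⟩ => ⟨e, he.trans h, hb⟩

/-- Left multiplication by `y` maps a span into a submodule if it does so on generators. -/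
theorem mul_span_mem {S : Set A} {C : Submodule K A} {y : A} (h : ∀ x ∈ S, y * x ∈ C) {x : A}
    (hx : x ∈ Submodule.span K S) : y * x ∈ C := by
  induction hx using Submodule.span_induction with
  | mem x hx => exact h x hx
  | zero => simp
  | add x z _ _ h1 h2 => rw [mul_add]; exact C.add_mem h1 h2
  | smul r x _ h1 => rw [mul_smul_comm]; exact C.smul_mem r h1

/-- Every index in the run exceeds `a + 1`. -/
theorem commute_run (hcomm : ∀ k l, k + 1 < l → τ k * τ l = τ l * τ k) {a e : ℕ} (h : a + e < m) :
    τ a * run τ m e = run τ m e * τ a := by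
  induction e with
  | zero => simp [run]
  | succ e ih =>
    rw [run, ← mul_assoc, hcomm a (m - e) (by omega), mul_assoc, ih (by omega), mul_assoc]

/-- The space `runSpan τ m B d` is closed under left multiplication by `P` and by the last `d` of
the elements `τ 0, …, τ m`, if `B` is so for `P` and `τ 0, …, τ (m - 1)`. -/
theorem runSpan_closed {P : Subalgebra K A}
    (hl : ∀ k, ∀ p ∈ P, ∃ p' ∈ P, ∃ p'' ∈ P, p * τ k = τ k * p' + p'')
    (hsq : ∀ k, τ k * τ k ∈ P)
    (hcomm : ∀ k l, k + 1 < l → τ k * τ l = τ l * τ k)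
    (hbr : ∀ k, ∃ p ∈ P, τ (k + 1) * τ k * τ (k + 1) = τ k * τ (k + 1) * τ k + p)
    (hP : ∀ p ∈ P, ∀ b ∈ B, p * b ∈ B) (hB : ∀ k < m, ∀ b ∈ B, τ k * b ∈ B) (d : ℕ)
    (hd : d ≤ m + 1) :
    (∀ p ∈ P, ∀ x ∈ runSpan τ m B d, p * x ∈ runSpan τ m B d) ∧
    (∀ a ≤ m, m + 1 ≤ a + d → ∀ x ∈ runSpan τ m B d, τ a * x ∈ runSpan τ m B d) := by
  induction d with
  | zero =>
    refine ⟨fun p hp x hx => mul_span_mem ?_ hx, fun a h1 h2 => by omega⟩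
    rintro _ ⟨e, he, b, hb, rfl⟩
    obtain rfl := Nat.le_zero.1 he
    simpa [run] using run_mul_mem (τ := τ) (m := m) (e := 0) le_rfl (hP p hp b hb)
  | succ d ih =>
    obtain ⟨ih1, ih2⟩ := ih (by omega)
    have hmono := runSpan_mono (τ := τ) (m := m) (B := B) d.le_succ
    have hj : ∀ x ∈ runSpan τ m B d, τ (m - d) * x ∈ runSpan τ m B (d + 1) := by
      refine fun x hx => mul_span_mem ?_ hx
      rintro _ ⟨e, he, b, hb, rfl⟩
      -- A run of length exactly d is lengthened by the new factor. Past a shorter run the factor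
      -- commutes and is absorbed by `B`.
      rcases he.eq_or_lt with rfl | he
      · rw [← mul_assoc]
        exact run_mul_mem (τ := τ) (m := m) (e := e + 1) le_rfl hb
      · rw [← mul_assoc, commute_run hcomm (by omega), mul_assoc]
        exact run_mul_mem (by omega) (hB _ (by omega) b hb)
    refine ⟨fun p hp x hx => mul_span_mem ?_ hx, fun a h1 h2 x hx => mul_span_mem ?_ hx⟩
    · rintro _ ⟨e, he, b, hb, rfl⟩
      rcases he.eq_or_lt with rfl | he
      · obtain ⟨p', hp', p'', hp'', h⟩ := hl (m - d) p hp
        rw [run, mul_assoc, ← mul_assoc, h, add_mul, mul_assoc]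
        exact add_mem (hj _ (ih1 p' hp' _ (run_mul_mem le_rfl hb)))
          (hmono (ih1 p'' hp'' _ (run_mul_mem le_rfl hb)))
      · exact hmono (ih1 p hp _ (run_mul_mem (by omega) hb))
    · rintro _ ⟨e, he, b, hb, rfl⟩
      rcases he.eq_or_lt with rfl | he
      · rw [run, mul_assoc]
        -- Position of `a` relative to the leading index of the run: equal gives a square, the next
        -- one a braid, and anything larger commutes.
        rcases (show a = m - d ∨ a = m - d + 1 ∨ m - d + 1 < a by omega) with rfl | rfl | h
        · rw [← mul_assoc]
          exact hmono (ih1 _ (hsq _) _ (run_mul_mem le_rfl hb))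
        · obtain ⟨d, rfl⟩ : ∃ d', d = d' + 1 := ⟨d - 1, by omega⟩
          obtain ⟨p, hp, h⟩ := hbr (m - (d + 1))
          have h3 : m - d = m - (d + 1) + 1 := by omega
          rw [run, mul_assoc, h3, ← mul_assoc, ← mul_assoc, h, add_mul]
          refine add_mem ?_ (hmono (ih1 p hp _ (run_mul_mem (by omega) hb)))
          -- After the braid move the rightmost factor has an index too small to meet the rest of
          -- the run. It passes through to `B`, and the other two factors lengthen the run.
          have h4 : τ (m - (d + 1)) * τ (m - (d + 1) + 1) * τ (m - (d + 1)) * (run τ m d * b) =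
              run τ m (d + 1 + 1) * (τ (m - (d + 1)) * b) := by
            rw [mul_assoc, ← mul_assoc _ (run τ m d), commute_run hcomm (by omega)]
            simp only [run, mul_assoc, h3]
          rw [h4]
          exact run_mul_mem le_rfl (hB _ (by omega) b hb)
        · rw [← mul_assoc, ← hcomm _ _ h, mul_assoc]
          exact hj _ (ih2 a h1 (by omega) _ (run_mul_mem le_rfl hb))
      · rcases (show a = m - d ∨ m - d < a by omega) with rfl | h
        · exact hj _ (run_mul_mem (by omega) hb)
        · exact hmono (ih2 a h1 (by omega) _ (run_mul_mem (by omega) hb))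

/-- The right `P`-span of a family. -/
def rightSpan (P : Subalgebra K A) {ι : Type*} (g : ι → A) : Submodule K A :=
  Submodule.span K {x | ∃ i, ∃ p ∈ P, g i * p = x}

theorem mem_rightSpan {P : Subalgebra K A} {ι : Type*} [Fintype ι] [DecidableEq ι] {g : ι → A}
    {x : A} (hx : x ∈ rightSpan P g) : ∃ p : ι → A, (∀ i, p i ∈ P) ∧ x = ∑ i, g i * p i := by
  induction hx using Submodule.span_induction with
  | mem x hx =>
    obtain ⟨i, p, hp, rfl⟩ := hx
    refine ⟨Pi.single i p, fun j => ?_, ?_⟩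
    · by_cases h : j = i
      · subst h; simpa
      · simp [h]
    · rw [Finset.sum_eq_single i] <;> simp +contextual
  | zero => exact ⟨0, fun _ => P.zero_mem, by simp⟩
  | add x y _ _ h1 h2 =>
    obtain ⟨p, hp, rfl⟩ := h1
    obtain ⟨q, hq, rfl⟩ := h2
    exact ⟨p + q, fun i => P.add_mem (hp i) (hq i), by simp [mul_add, Finset.sum_add_distrib]⟩
  | smul r x _ h1 =>
    obtain ⟨p, hp, rfl⟩ := h1
    exact ⟨r • p, fun i => P.smul_mem (hp i) r, by simp [Finset.smul_sum]⟩

/-- A family of `(m + 1)!` elements whose right `P`-span is closed under left multiplication by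
`P` and `τ 0, …, τ (m - 1)`. -/
theorem exists_rightSpan_closed {P : Subalgebra K A}
    (hl : ∀ k, ∀ p ∈ P, ∃ p' ∈ P, ∃ p'' ∈ P, p * τ k = τ k * p' + p'')
    (hsq : ∀ k, τ k * τ k ∈ P)
    (hcomm : ∀ k l, k + 1 < l → τ k * τ l = τ l * τ k)
    (hbr : ∀ k, ∃ p ∈ P, τ (k + 1) * τ k * τ (k + 1) = τ k * τ (k + 1) * τ k + p) (m : ℕ) :
    ∃ (ι : Type) (_ : Fintype ι) (g : ι → A) (i₀ : ι), Fintype.card ι = (m + 1).factorial ∧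
      g i₀ = 1 ∧ (∀ p ∈ P, ∀ b ∈ rightSpan P g, p * b ∈ rightSpan P g) ∧
      ∀ k < m, ∀ b ∈ rightSpan P g, τ k * b ∈ rightSpan P g := by
  induction m with
  | zero =>
    refine ⟨Unit, inferInstance, fun _ => 1, (), by simp, rfl, fun p hp b hb => mul_span_mem ?_ hb,
      by simp⟩
    rintro _ ⟨i, q, hq, rfl⟩
    exact Submodule.subset_span ⟨(), p * q, P.mul_mem hp hq, by rw [one_mul, one_mul]⟩
  | succ m ih =>
    obtain ⟨ι, _, g, i₀, hcard, h1, hP, hB⟩ := ih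
    have hC := runSpan_closed hl hsq hcomm hbr hP hB (m + 1) le_rfl
    -- The m + 2 runs play the role of coset representatives of S_{m+1} in S_{m+2}. This multiplies
    -- the size of the family by m + 2.
    have heq : rightSpan P (fun x : Fin (m + 2) × ι => run τ m x.1 * g x.2) =
        runSpan τ m (rightSpan P g) (m + 1) := by
      apply le_antisymm
      · refine Submodule.span_le.2 ?_
        rintro _ ⟨⟨e, i⟩, p, hp, rfl⟩
        dsimp only
        rw [mul_assoc]
        exact run_mul_mem (by omega) (Submodule.subset_span ⟨i, p, hp, rfl⟩)
      · refine Submodule.span_le.2 ?_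
        rintro _ ⟨e, he, b, hb, rfl⟩
        refine mul_span_mem ?_ hb
        rintro _ ⟨i, p, hp, rfl⟩
        exact Submodule.subset_span ⟨(⟨e, by omega⟩, i), p, hp, mul_assoc _ _ _⟩
    refine ⟨Fin (m + 2) × ι, inferInstance, fun x => run τ m x.1 * g x.2, (0, i₀), ?_, by simp [run, h1], ?_, ?_⟩
    · rw [Fintype.card_prod, hcard, Fintype.card_fin, Nat.factorial_succ (m + 1)]
    · rw [heq]; exact hC.1
    · rw [heq]; exact fun k hk => hC.2 k (by omega) (by omega)

end Spanning

/-! ### Polynomials inside the algebra and sliding through crossings -/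

section Algebra

open MvPolynomial Equiv

variable {K : Type*} [Field K] {I : Type*} [DecidableEq I] [Fintype I]
  {D : BorcherdsCartanDatum I} {ν : I → ℕ}

variable (K D) in
/-- The idempotent `1_s` of `R(ν)`. -/
noncomputable def idem (s : Seq ν) : R K D ν := gen K D ν (.idem s)

variable (K D) in
/-- The crossing `τ_{k,s}` of `R(ν)`. -/
noncomputable def crossing (k : ℕ) (hk : k + 1 < ht ν) (s : Seq ν) : R K D ν :=
  gen K D ν (.cross k hk s)

variable (K D) in
/-- The dot on strand `k`, for all sequences at once. -/
noncomputable def dot (k : Fin (ht ν)) : R K D ν := ∑ s : Seq ν, gen K D ν (.dot k s)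

theorem mk_rel {x y : FreeAlgebra K (Gen ν)} (h : Rel K D ν x y) :
    RingQuot.mkAlgHom K (Rel K D ν) x = RingQuot.mkAlgHom K (Rel K D ν) y :=
  RingQuot.mkAlgHom_rel K h

theorem mk_fe (s : Seq ν) : RingQuot.mkAlgHom K (Rel K D ν) (fe K s) = idem K D s := rfl

theorem mk_ft (k : ℕ) (hk : k + 1 < ht ν) (s : Seq ν) :
    RingQuot.mkAlgHom K (Rel K D ν) (ft K k hk s) = crossing K D k hk s := rfl

theorem mk_fx' (k : ℕ) (hk : k < ht ν) (s : Seq ν) :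
    RingQuot.mkAlgHom K (Rel K D ν) (fx K k hk s) = gen K D ν (.dot ⟨k, hk⟩ s) := rfl

theorem idem_mul_self (s : Seq ν) : idem K D s * idem K D s = idem K D s := by
  simpa [mk_fe] using mk_rel (K := K) (D := D) (.idem_self s)

theorem idem_mul_ne {s t : Seq ν} (h : s ≠ t) : idem K D s * idem K D t = 0 := by
  simpa [mk_fe] using mk_rel (K := K) (D := D) (.idem_ne s t h)

theorem sum_idem : ∑ s : Seq ν, idem K D s = 1 := by
  simpa [mk_fe] using mk_rel (K := K) (D := D) (ν := ν) .idem_sum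

theorem dot_mul_idem (k : Fin (ht ν)) (s : Seq ν) :
    dot K D k * idem K D s = gen K D ν (.dot k s) := by
  have h (s : Seq ν) : gen K D ν (.dot k s) * idem K D s = gen K D ν (.dot k s) := by
    simpa [mk_fe, mk_fx'] using mk_rel (K := K) (D := D) (.dot_bot k.1 k.2 s)
  rw [dot, Finset.sum_mul, Finset.sum_eq_single s, h]
  · intro t _ ht
    rw [← h, mul_assoc, idem_mul_ne ht, mul_zero]
  · simp

theorem idem_mul_dot (k : Fin (ht ν)) (s : Seq ν) :
    idem K D s * dot K D k = gen K D ν (.dot k s) := by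
  have h (s : Seq ν) : idem K D s * gen K D ν (.dot k s) = gen K D ν (.dot k s) := by
    simpa [mk_fe, mk_fx'] using mk_rel (K := K) (D := D) (.dot_top k.1 k.2 s)
  rw [dot, Finset.mul_sum, Finset.sum_eq_single s, h]
  · intro t _ ht
    rw [← h, ← mul_assoc, idem_mul_ne ht.symm, zero_mul]
  · simp

theorem mk_fx (k : ℕ) (hk : k < ht ν) (s : Seq ν) :
    RingQuot.mkAlgHom K (Rel K D ν) (fx K k hk s) = dot K D ⟨k, hk⟩ * idem K D s := by
  rw [mk_fx', dot_mul_idem]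

theorem commute_dot_idem (k : Fin (ht ν)) (s : Seq ν) : Commute (dot K D k) (idem K D s) := by
  rw [Commute, SemiconjBy, dot_mul_idem, idem_mul_dot]

theorem mul_crossing (k : ℕ) (hk : k + 1 < ht ν) (s : Seq ν) :
    idem K D (s.swap k hk) * crossing K D k hk s = crossing K D k hk s := by
  simpa [mk_fe, mk_ft] using mk_rel (K := K) (D := D) (.cross_top k hk s)

theorem crossing_mul (k : ℕ) (hk : k + 1 < ht ν) (s : Seq ν) :
    crossing K D k hk s * idem K D s = crossing K D k hk s := by
  simpa [mk_fe, mk_ft] using mk_rel (K := K) (D := D) (.cross_bot k hk s)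

/-- Elements of `R(ν)` agree if they agree on every bottom sequence. -/
theorem ext_idem {a b : R K D ν} (h : ∀ s, a * idem K D s = b * idem K D s) : a = b := by
  rw [← mul_one a, ← mul_one b, ← sum_idem, Finset.mul_sum, Finset.mul_sum]
  exact Finset.sum_congr rfl fun s _ => h s

theorem commute_dot (k l : Fin (ht ν)) : dot K D k * dot K D l = dot K D l * dot K D k := by
  refine ext_idem fun s => ?_
  have h := mk_rel (K := K) (D := D) (.dot_dot k.1 l.1 k.2 l.2 s)
  rw [map_mul, map_mul, mk_fx, mk_fx, mul_assoc, ← mul_assoc (idem K D s), idem_mul_dot,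
    ← dot_mul_idem, mul_assoc, idem_mul_self, mul_assoc, ← mul_assoc (idem K D s), idem_mul_dot,
    ← dot_mul_idem, mul_assoc, idem_mul_self] at h
  simpa only [mul_assoc] using h

theorem dot_comm_of_mem : ∀ a ∈ Set.range (dot K D (ν := ν)), ∀ b ∈ Set.range (dot K D (ν := ν)),
    a * b = b * a := by
  rintro _ ⟨k, rfl⟩ _ ⟨l, rfl⟩
  exact commute_dot k l

open scoped IsMulCommutative in
variable (K D ν) in
/-- Evaluation of polynomials at the dots. -/
noncomputable def evalDots : MvPolynomial (Fin (ht ν)) K →ₐ[K] R K D ν :=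
  -- Evaluation of commutative polynomials needs a commutative target, here the subalgebra generated
  -- by the dots.
  have := Algebra.isMulCommutative_adjoin K (dot_comm_of_mem (K := K) (D := D) (ν := ν))
  (Algebra.adjoin K (Set.range (dot K D (ν := ν)))).val.comp
    (aeval (R := K) (S₁ := Algebra.adjoin K (Set.range (dot K D (ν := ν))))
      fun k => ⟨dot K D k, Algebra.subset_adjoin ⟨k, rfl⟩⟩)

theorem evalDots_X (k : Fin (ht ν)) : evalDots K D ν (X k) = dot K D k := by
  simp [evalDots]

theorem commute_evalDots_idem (g : MvPolynomial (Fin (ht ν)) K) (s : Seq ν) :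
    Commute (evalDots K D ν g) (idem K D s) := by
  induction g using MvPolynomial.induction_on with
  | C a => rw [← algebraMap_eq, AlgHom.commutes]; exact Algebra.commutes _ _
  | add p q hp hq => rw [map_add]; exact hp.add_left hq
  | mul_X p k hp => rw [map_mul, evalDots_X]; exact hp.mul_left (commute_dot_idem k s)

variable (K D ν) in
/-- The polynomial subalgebra: a polynomial in the dots for every sequence. -/
noncomputable def diagonal : (Seq ν → MvPolynomial (Fin (ht ν)) K) →ₐ[K] R K D ν :=
  AlgHom.ofLinearMap
    { toFun := fun f => ∑ s, evalDots K D ν (f s) * idem K D s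
      map_add' := fun f g => by simp [add_mul, Finset.sum_add_distrib]
      map_smul' := fun r f => by simp [Finset.smul_sum] }
    (by simp [sum_idem])
    (by
      intro f g
      refine ext_idem fun s => ?_
      have h (f : Seq ν → MvPolynomial (Fin (ht ν)) K) :
          (∑ t, evalDots K D ν (f t) * idem K D t) * idem K D s =
            evalDots K D ν (f s) * idem K D s := by
        rw [Finset.sum_mul, Finset.sum_eq_single s, mul_assoc, idem_mul_self]
        · intro t _ ht
          rw [mul_assoc, idem_mul_ne ht, mul_zero]
        · simp
      simp only [LinearMap.coe_mk, AddHom.coe_mk]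
      rw [h, mul_assoc, h, (commute_evalDots_idem (g s) s).eq, ← mul_assoc, h, mul_assoc,
        ← (commute_evalDots_idem (g s) s).eq, Pi.mul_apply, map_mul, mul_assoc])

theorem diagonal_apply (f : Seq ν → MvPolynomial (Fin (ht ν)) K) :
    diagonal K D ν f = ∑ s, evalDots K D ν (f s) * idem K D s := rfl

theorem diagonal_mul_idem (f : Seq ν → MvPolynomial (Fin (ht ν)) K) (s : Seq ν) :
    diagonal K D ν f * idem K D s = evalDots K D ν (f s) * idem K D s := by
  rw [diagonal_apply, Finset.sum_mul, Finset.sum_eq_single s, mul_assoc, idem_mul_self]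
  · intro t _ ht
    rw [mul_assoc, idem_mul_ne ht, mul_zero]
  · simp

theorem idem_mul_diagonal (f : Seq ν → MvPolynomial (Fin (ht ν)) K) (s : Seq ν) :
    idem K D s * diagonal K D ν f = evalDots K D ν (f s) * idem K D s := by
  rw [diagonal_apply, Finset.mul_sum, Finset.sum_eq_single s,
    (commute_evalDots_idem _ s).eq, ← mul_assoc, idem_mul_self]
  · intro t _ ht
    rw [(commute_evalDots_idem _ t).eq, ← mul_assoc, idem_mul_ne ht.symm, zero_mul]
  · simp

theorem diagonal_single (s : Seq ν) (g : MvPolynomial (Fin (ht ν)) K) :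
    diagonal K D ν (Pi.single s g) = evalDots K D ν g * idem K D s := by
  rw [diagonal_apply, Finset.sum_eq_single s, Pi.single_eq_same]
  · intro t _ ht
    simp [ht]
  · simp

theorem idem_mem_range (s : Seq ν) : idem K D s ∈ (diagonal K D ν).range :=
  ⟨Pi.single s 1, by simpa using diagonal_single (K := K) (D := D) s 1⟩

theorem evalDots_mem_range (g : MvPolynomial (Fin (ht ν)) K) :
    evalDots K D ν g ∈ (diagonal K D ν).range :=
  ⟨fun _ => g, by
    change diagonal K D ν _ = _
    rw [diagonal_apply, ← Finset.mul_sum, sum_idem, mul_one]⟩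

theorem mem_range_of_idem {a : R K D ν}
    (h : ∀ s, a * idem K D s ∈ (diagonal K D ν).range) : a ∈ (diagonal K D ν).range := by
  rw [← mul_one a, ← sum_idem, Finset.mul_sum]
  exact sum_mem fun s _ => h s

theorem dot_mul_crossing (k : ℕ) (hk : k + 1 < ht ν) (s : Seq ν) (l : Fin (ht ν)) :
    dot K D l * crossing K D k hk s =
      RingQuot.mkAlgHom K (Rel K D ν) (fx K l.1 l.2 (s.swap k hk) * ft K k hk s) := by
  rw [map_mul, mk_fx, mk_ft, mul_assoc, mul_crossing]

theorem crossing_mul_dot (k : ℕ) (hk : k + 1 < ht ν) (s : Seq ν) (l : Fin (ht ν)) :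
    crossing K D k hk s * dot K D l =
      RingQuot.mkAlgHom K (Rel K D ν) (ft K k hk s * fx K l.1 l.2 s) := by
  rw [map_mul, mk_fx, mk_ft, (commute_dot_idem _ _).eq, ← mul_assoc, crossing_mul]

theorem crossing_mul_dot_of_ne (k : ℕ) (hk : k + 1 < ht ν) (s : Seq ν) (l : Fin (ht ν))
    (h : l.1 ≠ k) (h' : l.1 ≠ k + 1) :
    crossing K D k hk s * dot K D l = dot K D l * crossing K D k hk s := by
  rw [dot_mul_crossing, crossing_mul_dot, mk_rel (.dot_cross k l.1 hk l.2 h h' s)]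

/-- Sliding a polynomial through a crossing of two strands labelled by one real `i`. -/
theorem slide_real (k : ℕ) (hk : k + 1 < ht ν) (s : Seq ν)
    (h : s.1 ⟨k, by omega⟩ = s.1 ⟨k + 1, hk⟩)
    (hr : D.a (s.1 ⟨k, by omega⟩) (s.1 ⟨k, by omega⟩) = 2) (g : MvPolynomial (Fin (ht ν)) K) :
    ∃ q, crossing K D k hk s * evalDots K D ν g =
        evalDots K D ν (rename (adj k hk) g) * crossing K D k hk s +
          evalDots K D ν q * idem K D s ∧
      (X ⟨k, by omega⟩ - X ⟨k + 1, hk⟩) * q = g - rename (adj k hk) g := by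
  induction g using MvPolynomial.induction_on with
  | C a =>
    refine ⟨0, ?_, by simp⟩
    rw [rename_C, ← algebraMap_eq, AlgHom.commutes, ← Algebra.commutes, map_zero, zero_mul, add_zero]
  | add p q hp hq =>
    obtain ⟨p', h1, h2⟩ := hp
    obtain ⟨q', h3, h4⟩ := hq
    refine ⟨p' + q', ?_, ?_⟩
    · rw [map_add, mul_add, h1, h3]; simp only [map_add, add_mul]; abel
    · rw [mul_add, h2, h4, map_add]; ring
  | mul_X p l hp =>
    obtain ⟨q, h1, h2⟩ := hp
    -- Here `ε` is the divided difference of a single variable: 1, -1 or 0.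
    have key : ∃ ε : MvPolynomial (Fin (ht ν)) K, crossing K D k hk s * dot K D l =
        dot K D (adj k hk l) * crossing K D k hk s + evalDots K D ν ε * idem K D s ∧
        ε * (X ⟨k, by omega⟩ - X ⟨k + 1, hk⟩) = X l - X (adj k hk l) := by
      by_cases hl : l.1 = k
      · obtain rfl : l = ⟨k, Nat.lt_of_succ_lt hk⟩ := Fin.ext hl
        refine ⟨1, ?_, by simp⟩
        rw [crossing_mul_dot, mk_rel (.slide_real_right k hk s _ rfl h.symm hr), swap_apply_left,
          dot_mul_crossing, map_add, mk_fe, map_one, one_mul]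
      · by_cases hl' : l.1 = k + 1
        · obtain rfl : l = ⟨k + 1, hk⟩ := Fin.ext hl'
          refine ⟨-1, ?_, by simp⟩
          have := mk_rel (K := K) (.slide_real_left k hk s _ rfl h.symm hr)
          rw [crossing_mul_dot, swap_apply_right, dot_mul_crossing, this, map_add, mk_fe, map_neg,
            map_one, show (-1 : R K D ν) * idem K D s = -idem K D s from neg_one_mul (idem K D s),
            add_neg_cancel_right]
        · refine ⟨0, ?_, ?_⟩ <;>
            rw [swap_apply_of_ne_of_ne (by simpa [Fin.ext_iff] using hl)
              (by simpa [Fin.ext_iff] using hl')]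
          · rw [crossing_mul_dot_of_ne k hk s l hl hl']; simp
          · simp
    obtain ⟨ε, h3, h4⟩ := key
    -- The twisted Leibniz rule for divided differences.
    refine ⟨rename (adj k hk) p * ε + q * X l, ?_, ?_⟩
    · rw [map_mul, ← mul_assoc, h1, add_mul, mul_assoc, evalDots_X, h3, mul_assoc _ (idem K D s),
        ← (commute_dot_idem l s).eq]
      simp only [map_mul, map_add, rename_X, evalDots_X, mul_add, add_mul, mul_assoc]
      abel
    · rw [map_mul, rename_X]
      linear_combination X l * h2 + rename (adj k hk) p * h4

/-- Sliding a polynomial through any other crossing. -/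
theorem slide_other (k : ℕ) (hk : k + 1 < ht ν) (s : Seq ν)
    (h : ¬ (s.1 ⟨k, by omega⟩ = s.1 ⟨k + 1, hk⟩ ∧
      D.a (s.1 ⟨k, by omega⟩) (s.1 ⟨k, by omega⟩) = 2)) (g : MvPolynomial (Fin (ht ν)) K) :
    crossing K D k hk s * evalDots K D ν g =
        evalDots K D ν (rename (adj k hk) g) * crossing K D k hk s := by
  have h' : s.1 ⟨k, by omega⟩ ≠ s.1 ⟨k + 1, hk⟩ ∨
      D.a (s.1 ⟨k, by omega⟩) (s.1 ⟨k, by omega⟩) ≤ 0 := by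
    rcases D.diag (s.1 ⟨k, by omega⟩) with h1 | h1
    · exact .inl fun h2 => h ⟨h2, h1⟩
    · exact .inr h1.1
  induction g using MvPolynomial.induction_on with
  | C a => rw [rename_C, ← algebraMap_eq, AlgHom.commutes, ← Algebra.commutes]
  | add p q hp hq => rw [map_add, mul_add, hp, hq]; simp only [map_add, add_mul]
  | mul_X p l hp =>
    have key : crossing K D k hk s * dot K D l = dot K D (adj k hk l) * crossing K D k hk s := by
      by_cases hl : l.1 = k
      · obtain rfl : l = ⟨k, Nat.lt_of_succ_lt hk⟩ := Fin.ext hl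
        rw [crossing_mul_dot, mk_rel (.slide_right k hk s _ _ rfl rfl h'), swap_apply_left,
          dot_mul_crossing]
      · by_cases hl' : l.1 = k + 1
        · obtain rfl : l = ⟨k + 1, hk⟩ := Fin.ext hl'
          rw [crossing_mul_dot, swap_apply_right, dot_mul_crossing,
            mk_rel (.slide_left k hk s _ _ rfl rfl h')]
        · rw [swap_apply_of_ne_of_ne (by simpa [Fin.ext_iff] using hl)
              (by simpa [Fin.ext_iff] using hl'), crossing_mul_dot_of_ne k hk s l hl hl']
    rw [map_mul, ← mul_assoc, hp, mul_assoc, evalDots_X, key, map_mul, rename_X, map_mul,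
      evalDots_X, mul_assoc]

/-- Sliding a polynomial through a crossing. -/
theorem slide (k : ℕ) (hk : k + 1 < ht ν) (s : Seq ν) (g : MvPolynomial (Fin (ht ν)) K) :
    ∃ q, crossing K D k hk s * evalDots K D ν g =
        evalDots K D ν (rename (adj k hk) g) * crossing K D k hk s +
          evalDots K D ν q * idem K D s := by
  by_cases h : s.1 ⟨k, by omega⟩ = s.1 ⟨k + 1, hk⟩ ∧
      D.a (s.1 ⟨k, by omega⟩) (s.1 ⟨k, by omega⟩) = 2
  · obtain ⟨q, hq, -⟩ := slide_real k hk s h.1 h.2 g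
    exact ⟨q, hq⟩
  · exact ⟨0, by rw [slide_other k hk s h, map_zero, zero_mul, add_zero]⟩

end Algebra

/-! ### Global crossings and the spanning family -/

section Algebra

open MvPolynomial Equiv

variable {K : Type*} [Field K] {I : Type*} [DecidableEq I] [Fintype I]
  {D : BorcherdsCartanDatum I} {ν : I → ℕ}

theorem neg_mem_range {a : R K D ν} (h : a ∈ (diagonal K D ν).range) :
    -a ∈ (diagonal K D ν).range := by
  obtain ⟨f, rfl⟩ := h
  exact ⟨-f, map_neg (diagonal K D ν) f⟩

variable (K D ν) in
/-- The crossing of the strands `k` and `k + 1`, for all sequences at once. -/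
noncomputable def tau (k : ℕ) : R K D ν :=
  if hk : k + 1 < ht ν then ∑ s, crossing K D k hk s else 0

theorem tau_mul_idem (k : ℕ) (hk : k + 1 < ht ν) (s : Seq ν) :
    tau K D ν k * idem K D s = crossing K D k hk s := by
  rw [tau, dif_pos hk, Finset.sum_mul, Finset.sum_eq_single s, crossing_mul]
  · intro t _ ht
    rw [← crossing_mul, mul_assoc, idem_mul_ne ht, mul_zero]
  · simp

theorem tau_eq_zero {k : ℕ} (hk : ¬ k + 1 < ht ν) : tau K D ν k = 0 := dif_neg hk

theorem tau_mul_crossing (k l : ℕ) (hk : k + 1 < ht ν) (hl : l + 1 < ht ν) (s : Seq ν) :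
    tau K D ν k * crossing K D l hl s = crossing K D k hk (s.swap l hl) * crossing K D l hl s := by
  rw [← mul_crossing, ← mul_assoc, tau_mul_idem k hk, mul_crossing]

theorem tau_sq (k : ℕ) : tau K D ν k * tau K D ν k ∈ (diagonal K D ν).range := by
  by_cases hk : k + 1 < ht ν
  · refine mem_range_of_idem fun s => ?_
    rw [mul_assoc, tau_mul_idem k hk, tau_mul_crossing k k hk hk, ← mk_ft, ← mk_ft, ← map_mul]
    by_cases h : s.1 ⟨k, by omega⟩ = s.1 ⟨k + 1, hk⟩
    · rw [mk_rel (.sq_eq k hk s _ rfl h.symm), map_zero]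
      exact zero_mem _
    · by_cases hf : D.form (s.1 ⟨k, by omega⟩) (s.1 ⟨k + 1, hk⟩) = 0
      · rw [mk_rel (.sq_orth k hk s _ _ rfl rfl h hf), mk_fe]
        exact idem_mem_range s
      · rw [mk_rel (.sq_edge k hk s _ _ rfl rfl h hf)]
        simp only [map_add, map_pow, mk_fx]
        have hx (l : Fin (ht ν)) : dot K D l * idem K D s ∈ (diagonal K D ν).range := by
          rw [← evalDots_X]
          exact mul_mem (evalDots_mem_range _) (idem_mem_range s)
        exact add_mem (pow_mem (hx _) _) (pow_mem (hx _) _)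
  · rw [tau_eq_zero hk, zero_mul]; exact zero_mem _

theorem tau_comm (k l : ℕ) (h : k + 1 < l) :
    tau K D ν k * tau K D ν l = tau K D ν l * tau K D ν k := by
  by_cases hl : l + 1 < ht ν
  · have hk : k + 1 < ht ν := by omega
    refine ext_idem fun s => ?_
    rw [mul_assoc, mul_assoc, tau_mul_idem k hk, tau_mul_idem l hl, tau_mul_crossing k l hk hl,
      tau_mul_crossing l k hl hk, ← mk_ft, ← mk_ft, ← mk_ft, ← mk_ft, ← map_mul, ← map_mul,
      mk_rel (.cross_cross k l hk hl h s)]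
  · rw [tau_eq_zero hl, zero_mul, mul_zero]

/-- The correction differs from one sequence to another, but each time it is a polynomial. Summing
over the idempotents gives one diagonal element valid for all sequences. -/
theorem tau_braid (k : ℕ) : ∃ p ∈ (diagonal K D ν).range,
    tau K D ν (k + 1) * tau K D ν k * tau K D ν (k + 1) =
      tau K D ν k * tau K D ν (k + 1) * tau K D ν k + p := by
  by_cases hk : k + 2 < ht ν
  · have hs (s : Seq ν) : ∃ p, p ∈ (diagonal K D ν).range ∧
        tau K D ν k * tau K D ν (k + 1) * tau K D ν k * idem K D s =
        tau K D ν (k + 1) * tau K D ν k * tau K D ν (k + 1) * idem K D s + p * idem K D s := by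
      have e1 : tau K D ν k * tau K D ν (k + 1) * tau K D ν k * idem K D s =
          crossing K D k (by omega) ((s.swap k (by omega)).swap (k + 1) hk) *
            crossing K D (k + 1) hk (s.swap k (by omega)) * crossing K D k (by omega) s := by
        rw [mul_assoc, tau_mul_idem k (by omega), mul_assoc,
          tau_mul_crossing (k + 1) k hk, ← mul_assoc, tau_mul_crossing k _ (by omega)]
      have e2 : tau K D ν (k + 1) * tau K D ν k * tau K D ν (k + 1) * idem K D s =
          crossing K D (k + 1) hk ((s.swap (k + 1) hk).swap k (by omega)) *
            crossing K D k (by omega) (s.swap (k + 1) hk) * crossing K D (k + 1) hk s := by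
        rw [mul_assoc, tau_mul_idem (k + 1) hk, mul_assoc,
          tau_mul_crossing k (k + 1) (by omega) hk, ← mul_assoc, tau_mul_crossing (k + 1) k hk]
      rw [e1, e2]
      simp only [← mk_ft, ← map_mul]
      by_cases h : s.1 ⟨k, by omega⟩ = s.1 ⟨k + 2, hk⟩ ∧
          D.a (s.1 ⟨k, by omega⟩) (s.1 ⟨k, by omega⟩) = 2 ∧
          s.1 ⟨k, by omega⟩ ≠ s.1 ⟨k + 1, by omega⟩ ∧
          D.form (s.1 ⟨k, by omega⟩) (s.1 ⟨k + 1, by omega⟩) ≠ 0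
      · rw [mk_rel (.braid_real k hk s _ _ rfl rfl h.1.symm h.2.1 h.2.2.1 h.2.2.2), map_add,
          map_sum]
        refine ⟨_, ?_, congrArg _ (Finset.sum_mul _ _ _ |>.trans
          (Finset.sum_congr rfl fun c _ => (map_mul _ _ _).symm)).symm⟩
        have hx (l : Fin (ht ν)) : dot K D l * idem K D s ∈ (diagonal K D ν).range := by
          rw [← evalDots_X]
          exact mul_mem (evalDots_mem_range _) (idem_mem_range s)
        refine sum_mem fun c _ => ?_
        simp only [map_mul, map_pow, mk_fx]
        exact mul_mem (pow_mem (hx _) _) (pow_mem (hx _) _)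
      · exact ⟨0, zero_mem _, by
          rw [mk_rel (.braid k hk s _ _ _ rfl rfl rfl h), zero_mul, add_zero]⟩
    choose p hp hps using hs
    have h : tau K D ν k * tau K D ν (k + 1) * tau K D ν k =
        tau K D ν (k + 1) * tau K D ν k * tau K D ν (k + 1) + ∑ s, p s * idem K D s := by
      refine ext_idem fun s => ?_
      rw [hps, add_mul, Finset.sum_mul, Finset.sum_eq_single s, mul_assoc (p s), idem_mul_self]
      · intro t _ ht
        rw [mul_assoc, idem_mul_ne ht, mul_zero]
      · simp
    exact ⟨_, neg_mem_range (sum_mem fun s _ => mul_mem (hp s) (idem_mem_range s)),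
      eq_add_neg_of_add_eq h.symm⟩
  · exact ⟨0, zero_mem _, by rw [tau_eq_zero (k := k + 1) hk]; simp⟩

theorem diagonal_mul_tau (k : ℕ) {p : R K D ν} (hp : p ∈ (diagonal K D ν).range) :
    ∃ p' ∈ (diagonal K D ν).range, ∃ p'' ∈ (diagonal K D ν).range,
      p * tau K D ν k = tau K D ν k * p' + p'' := by
  by_cases hk : k + 1 < ht ν
  · obtain ⟨f, rfl⟩ := hp
    -- Sliding is available from right to left only. It is applied to the already permuted
    -- polynomial, so that the original one appears on the left.
    choose q hq using fun s => slide (K := K) (D := D) k hk s (rename (adj k hk) (f (s.swap k hk)))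
    refine ⟨diagonal K D ν fun s => rename (adj k hk) (f (s.swap k hk)), ⟨_, rfl⟩,
      -diagonal K D ν q, neg_mem_range ⟨_, rfl⟩, ?_⟩
    refine eq_add_neg_of_add_eq (Eq.symm ?_)
    refine ext_idem fun s => ?_
    have e : rename (adj k hk) (rename (adj k hk) (f (s.swap k hk))) = f (s.swap k hk) := by
      rw [rename_rename, show (adj k hk : Fin (ht ν) → Fin (ht ν)) ∘ adj k hk = id from
        funext fun p => by simp, rename_id, AlgHom.id_apply]
    rw [mul_assoc, diagonal_mul_idem, (commute_evalDots_idem _ s).eq, ← mul_assoc, tau_mul_idem k hk,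
      hq, e, add_mul, diagonal_mul_idem, mul_assoc]
    change _ = diagonal K D ν f * (tau K D ν k * _) + _
    rw [tau_mul_idem k hk, ← mul_crossing, ← mul_assoc,
      ← mul_assoc, diagonal_mul_idem, mul_assoc (evalDots K D ν _)]
  · exact ⟨0, zero_mem _, 0, zero_mem _, by rw [tau_eq_zero hk]; simp⟩

/-- `R(ν)` is spanned over polynomials by `(ht ν)!` elements, one of which is `1`. -/
theorem exists_spanning : ∃ (ι : Type) (_ : Fintype ι) (_ : DecidableEq ι) (g : ι → R K D ν)
    (i₀ : ι), Fintype.card ι = (ht ν).factorial ∧ g i₀ = 1 ∧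
    ∀ a, ∃ f : ι → Seq ν → MvPolynomial (Fin (ht ν)) K, a = ∑ i, g i * diagonal K D ν (f i) := by
  classical
  obtain ⟨ι, _, g, i₀, hcard, h1, hP, hB⟩ := exists_rightSpan_closed (K := K) (A := R K D ν)
    (τ := tau K D ν) (fun k p hp => diagonal_mul_tau k hp) tau_sq tau_comm tau_braid (ht ν - 1)
  refine ⟨ι, inferInstance, inferInstance, g, i₀, ?_, h1, fun a => ?_⟩
  · rw [hcard]
    -- For height 0 the truncated `ht ν - 1` gives 1!, which is also 0!.
    rcases Nat.eq_zero_or_pos (ht ν) with h | h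
    · rw [h]; rfl
    · rw [Nat.sub_add_cancel h]
  -- The span is stable under left multiplication by all generators and contains 1, so it is the
  -- whole algebra.
  · have key : ∀ x : FreeAlgebra K (Gen ν), ∀ b ∈ rightSpan (diagonal K D ν).range g,
        RingQuot.mkAlgHom K (Rel K D ν) x * b ∈ rightSpan (diagonal K D ν).range g := by
      intro x
      induction x using FreeAlgebra.induction with
      | grade0 r =>
        intro b hb
        rw [AlgHom.commutes, ← Algebra.smul_def]
        exact Submodule.smul_mem _ r hb
      | grade1 y =>
        intro b hb
        cases y with
        | idem s => exact hP _ (idem_mem_range s) b hb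
        | dot k s =>
          change gen K D ν (.dot k s) * b ∈ _
          rw [← dot_mul_idem, ← evalDots_X]
          exact hP _ (mul_mem (evalDots_mem_range _) (idem_mem_range s)) b hb
        | cross k hk s =>
          change crossing K D k hk s * b ∈ _
          rw [← tau_mul_idem k hk, mul_assoc]
          exact hB k (by omega) _ (hP _ (idem_mem_range s) b hb)
      | mul x y hx hy => intro b hb; rw [map_mul, mul_assoc]; exact hx _ (hy b hb)
      | add x y hx hy =>
        intro b hb; rw [map_add, add_mul]; exact add_mem (hx b hb) (hy b hb)
    obtain ⟨x, rfl⟩ := RingQuot.mkAlgHom_surjective K (Rel K D ν) a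
    have hone : (1 : R K D ν) ∈ rightSpan (diagonal K D ν).range g :=
      Submodule.subset_span ⟨i₀, 1, one_mem _, by rw [h1, one_mul]⟩
    obtain ⟨p, hp, hx⟩ := mem_rightSpan (key x 1 hone)
    choose f hf using hp
    refine ⟨f, ?_⟩
    rw [← mul_one (RingQuot.mkAlgHom K (Rel K D ν) x), hx]
    exact Finset.sum_congr rfl fun i _ => congrArg _ (hf i).symm

end Algebra

/-! ### Freeness on a delta function and the center -/

section Center

open MvPolynomial Equiv

variable {K : Type*} [Field K] {I : Type*} [DecidableEq I] [Fintype I]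
  {D : BorcherdsCartanDatum I} {ν : I → ℕ} {c : Seq ν}

theorem rep_idem (s : Seq ν) : rep K D c (idem K D s) = opE K c s := rep_gen K D c _

theorem rep_crossing (k : ℕ) (hk : k + 1 < ht ν) (s : Seq ν) :
    rep K D c (crossing K D k hk s) = opT K D c k hk * opE K c s := rep_gen K D c _

theorem rep_dot (k : Fin (ht ν)) : rep K D c (dot K D k) = opX K k := by
  rw [dot, map_sum]
  simp only [rep_gen, genAct]
  rw [← Finset.mul_sum, opE_sum, mul_one]

theorem rep_tau (k : ℕ) (hk : k + 1 < ht ν) : rep K D c (tau K D ν k) = opT K D c k hk := by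
  rw [tau, dif_pos hk, map_sum]
  simp only [rep_crossing]
  rw [← Finset.mul_sum, opE_sum, mul_one]

theorem rep_evalDots (g : MvPolynomial (Fin (ht ν)) K) (φ : RepSpace K ν)
    (w : Perm (Fin (ht ν))) :
    rep K D c (evalDots K D ν g) φ w =
      algebraMap (MvPolynomial (Fin (ht ν)) K) (Rat K (ht ν)) (rename w g) * φ w := by
  induction g using MvPolynomial.induction_on generalizing φ with
  | C a =>
    rw [rename_C, ← algebraMap_eq, AlgHom.commutes, AlgHom.commutes, Module.algebraMap_end_apply,
      Pi.smul_apply, Algebra.smul_def, ← IsScalarTower.algebraMap_apply]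
  | add p q hp hq => simp only [map_add, LinearMap.add_apply, Pi.add_apply, hp, hq, add_mul]
  | mul_X p k hp =>
    rw [map_mul, map_mul, Module.End.mul_apply, hp, evalDots_X, rep_dot, opX_apply, map_mul,
      rename_X, map_mul, zvar, mul_assoc]

theorem rep_diagonal (f : Seq ν → MvPolynomial (Fin (ht ν)) K) (φ : RepSpace K ν)
    (w : Perm (Fin (ht ν))) :
    rep K D c (diagonal K D ν f) φ w =
      algebraMap (MvPolynomial (Fin (ht ν)) K) (Rat K (ht ν)) (rename w (f (c.perm w))) * φ w := by
  have h (s : Seq ν) : rep K D c (evalDots K D ν (f s) * idem K D s) φ w =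
      if c.perm w = s then algebraMap (MvPolynomial (Fin (ht ν)) K) (Rat K (ht ν))
        (rename w (f (c.perm w))) * φ w else 0 := by
    rw [map_mul, Module.End.mul_apply, rep_evalDots, rep_idem, opE_apply]
    split_ifs with h
    · rw [h]
    · rw [mul_zero]
  rw [diagonal_apply, map_sum, LinearMap.sum_apply, Finset.sum_apply]
  simp only [h]
  simp

/-- The delta function at the identity. -/
noncomputable abbrev delta (K : Type*) [Field K] (ν : I → ℕ) (w : Perm (Fin (ht ν))) :
    RepSpace K ν := Pi.single w 1

/-- At the identity the permutation acts trivially on the variables and on `c`. The right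
coefficients of an element can therefore be read off as scalars of the field. -/
theorem rep_diagonal_delta (f : Seq ν → MvPolynomial (Fin (ht ν)) K) :
    rep K D c (diagonal K D ν f) (delta K ν 1) =
      algebraMap (MvPolynomial (Fin (ht ν)) K) (Rat K (ht ν)) (f c) • delta K ν 1 := by
  funext w
  rw [rep_diagonal, Pi.smul_apply, smul_eq_mul]
  by_cases h : w = 1
  · subst h
    simp
  · simp [h]

/-- The arguments of `crossCoeff` are exchanged because the delta function at w is seen from w s_k.
The coefficient is therefore nonzero when w(k) < w(k+1). -/
theorem opT_delta (k : ℕ) (hk : k + 1 < ht ν) (w : Perm (Fin (ht ν))) :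
    opT K D c k hk (delta K ν w) =
      diagCoeff K D c.1 (w ⟨k, Nat.lt_of_succ_lt hk⟩) (w ⟨k + 1, hk⟩) • delta K ν w +
      crossCoeff K D c.1 (w ⟨k + 1, hk⟩) (w ⟨k, Nat.lt_of_succ_lt hk⟩) •
        delta K ν (w * adj k hk) := by
  funext u
  have h : u * adj k hk = w ↔ u = w * adj k hk := by
    constructor
    · rintro rfl; simp [mul_assoc]
    · rintro rfl; simp [mul_assoc]
  simp only [opT_apply, Pi.add_apply, Pi.smul_apply, smul_eq_mul, Pi.single_apply, h]
  congr 1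
  · split_ifs with h1
    · rw [h1]
    · simp
  · split_ifs with h1
    · subst h1; simp
    · simp

/-- A strictly increasing bijection is an order isomorphism of a finite chain, and there is only
one. So every permutation other than 1 has an adjacent descent. -/
theorem eq_one_of_lt {n : ℕ} {w : Perm (Fin n)}
    (h : ∀ k (hk : k + 1 < n), w ⟨k, Nat.lt_of_succ_lt hk⟩ < w ⟨k + 1, hk⟩) : w = 1 := by
  have hm : StrictMono w := by
    cases n with
    | zero => exact fun a => a.elim0
    | succ n => exact Fin.strictMono_iff_lt_succ.2 fun i => h i.1 (by omega)
  have := Subsingleton.elim (hm.orderIsoOfSurjective w w.surjective) (OrderIso.refl _)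
  exact Equiv.ext fun p => congrArg (fun e : Fin n ≃o Fin n => e p) this

/-- A subspace containing the delta function at the identity and closed under crossings is
everything. -/
theorem eq_top_of_opT {W : Submodule (Rat K (ht ν)) (RepSpace K ν)} (h1 : delta K ν 1 ∈ W)
    (hT : ∀ k hk, ∀ φ ∈ W, opT K D c k hk φ ∈ W) : W = ⊤ := by
  have key : ∀ w, delta K ν w ∈ W := by
    intro w
    -- Induction on the word of w in lexicographic order: undoing a descent at k keeps the entries
    -- before k and lowers the entry at k.
    induction w using (InvImage.wf (fun w : Perm (Fin (ht ν)) => toLex (w : Fin (ht ν) → Fin (ht ν)))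
      wellFounded_lt).induction with
    | _ w ih =>
    by_cases hw : w = 1
    · rw [hw]; exact h1
    · obtain ⟨k, hk, hlt⟩ : ∃ k, ∃ hk : k + 1 < ht ν,
          w ⟨k + 1, hk⟩ < w ⟨k, Nat.lt_of_succ_lt hk⟩ := by
        by_contra! hcon
        refine hw (eq_one_of_lt fun k hk => (hcon k hk).lt_of_ne ?_)
        simp
      have hu := ih (w * adj k hk) (by
        refine ⟨⟨k, Nat.lt_of_succ_lt hk⟩, fun j hj => ?_, ?_⟩
        · have hj' : j.1 < k := hj
          change w (adj k hk j) = w j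
          rw [swap_apply_of_ne_of_ne] <;> · intro h; rw [h] at hj'; simp at hj'
        · change w (adj k hk _) < w _
          rwa [swap_apply_left])
      have h2 := hT k hk _ hu
      rw [opT_delta, mul_assoc, swap_mul_self, mul_one, Perm.mul_apply, Perm.mul_apply,
        swap_apply_left, swap_apply_right] at h2
      have h3 := (Submodule.add_mem_iff_right W (W.smul_mem _ hu)).1 h2
      -- The descent puts the larger index first, which is the direction where the coefficient is
      -- nonzero.
      exact (W.smul_mem_iff (crossCoeff_ne_zero hlt)).1 h3
  rw [eq_top_iff]
  intro φ _
  have : φ = ∑ w, φ w • delta K ν w := by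
    funext u
    simp [Finset.sum_apply, Pi.single_apply]
  rw [this]
  exact sum_mem fun w _ => W.smul_mem _ (key w)

/-- A spanning family of `(ht ν)!` elements acts freely on the delta function at the identity. -/
theorem linearIndependent_rep_delta {ι : Type} [Fintype ι] {g : ι → R K D ν}
    (hcard : Fintype.card ι = (ht ν).factorial)
    (hg : ∀ a, ∃ f : ι → Seq ν → MvPolynomial (Fin (ht ν)) K, a = ∑ i, g i * diagonal K D ν (f i)) :
    LinearIndependent (Rat K (ht ν)) fun i => rep K D c (g i) (delta K ν 1) := by
  apply linearIndependent_of_top_le_span_of_card_eq_finrank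
  -- Right coefficients become scalars on this vector, so its whole orbit lies in the span of the
  -- family. Stability of the span under crossings follows, as a crossing times a spanning element
  -- is again in the algebra.
  · have hmem (a : R K D ν) : rep K D c a (delta K ν 1) ∈ Submodule.span (Rat K (ht ν))
        (Set.range fun i => rep K D c (g i) (delta K ν 1)) := by
      obtain ⟨f, rfl⟩ := hg a
      rw [map_sum, LinearMap.sum_apply]
      refine sum_mem fun i _ => ?_
      rw [map_mul, Module.End.mul_apply, rep_diagonal_delta, map_smul]
      exact Submodule.smul_mem _ _ (Submodule.subset_span ⟨i, rfl⟩)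
    refine (eq_top_of_opT (D := D) (c := c) ?_ ?_).ge
    · simpa using hmem 1
    · intro k hk φ hφ
      induction hφ using Submodule.span_induction with
      | mem x hx =>
        obtain ⟨i, rfl⟩ := hx
        have := hmem (tau K D ν k * g i)
        rwa [map_mul, Module.End.mul_apply, rep_tau k hk] at this
      | zero => rw [map_zero]; exact zero_mem _
      | add x y _ _ hx hy => rw [map_add]; exact add_mem hx hy
      | smul r x _ hx => rw [map_smul]; exact Submodule.smul_mem _ r hx
  · rw [hcard, Module.finrank_pi, Fintype.card_perm, Fintype.card_fin]

/-- In the representation attached to `c`, the delta function at the identity detects the polynomial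
with index `c`. -/
theorem diagonal_injective : Function.Injective (diagonal K D ν) := by
  rw [injective_iff_map_eq_zero]
  intro f hf
  funext c
  have h := rep_diagonal_delta (D := D) (c := c) f
  rw [hf, map_zero] at h
  have h1 := congrFun h 1
  simp only [LinearMap.zero_apply, Pi.zero_apply, Pi.smul_apply, Pi.single_eq_same, smul_eq_mul,
    mul_one] at h1
  exact (IsFractionRing.injective (MvPolynomial (Fin (ht ν)) K) (Rat K (ht ν)))
    (by rw [← h1, Pi.zero_apply, map_zero])

/-- A central element is a polynomial in the dots for every sequence. -/
theorem exists_diagonal_of_central {z : R K D ν} (hz : ∀ a, a * z = z * a) :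
    ∃ f, diagonal K D ν f = z := by
  obtain ⟨ι, _, _, g, i₀, hcard, h1, hg⟩ := exists_spanning (K := K) (D := D) (ν := ν)
  obtain ⟨f, rfl⟩ := hg z
  refine ⟨f i₀, ?_⟩
  have key (c : Seq ν) (i : ι) (hi : i ≠ i₀) : f i c = 0 := by
    set y := rep K D c (∑ i, g i * diagonal K D ν (f i)) (delta K ν 1) with hy
    -- If w moves k, the dot on strand k has different eigenvalues at w and at the identity.
    -- Commutation with this dot makes the component at w vanish.
    have hy0 (w : Perm (Fin (ht ν))) (hw : w ≠ 1) : y w = 0 := by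
      obtain ⟨k, hk⟩ : ∃ k, w k ≠ k := by
        by_contra! hcon
        exact hw (Equiv.ext hcon)
      have h2 := congrArg (fun a => rep K D c a (delta K ν 1) w) (hz (dot K D k))
      simp only [map_mul (rep K D c), Module.End.mul_apply, rep_dot] at h2
      have h3 : opX K k (delta K ν 1) = zvar K k • delta K ν 1 := by
        funext u
        rw [opX_apply, Pi.smul_apply, smul_eq_mul]
        by_cases hu : u = 1
        · subst hu; simp
        · simp [hu]
      rw [h3, map_smul, opX_apply, ← hy, Pi.smul_apply, smul_eq_mul, ← sub_eq_zero, ← sub_mul] at h2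
      exact (mul_eq_zero.1 h2).resolve_left (sub_ne_zero.2 ((zvar_injective K).ne hk))
    have hy1 : y = y 1 • delta K ν 1 := by
      funext w
      by_cases hw : w = 1
      · subst hw; simp
      · simp [hw, hy0]
    -- Two expansions of the same vector in the basis: one from the spanning family, one as a
    -- multiple of the vector of the element 1.
    have hsum : ∑ i, (algebraMap (MvPolynomial (Fin (ht ν)) K) (Rat K (ht ν)) (f i c) -
        if i = i₀ then y 1 else 0) • rep K D c (g i) (delta K ν 1) = 0 := by
      simp only [sub_smul, Finset.sum_sub_distrib, ite_smul, zero_smul]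
      rw [Finset.sum_ite_eq' Finset.univ i₀, if_pos (Finset.mem_univ _), h1, map_one,
        Module.End.one_apply, ← hy1, hy, map_sum, LinearMap.sum_apply, sub_eq_zero]
      refine Finset.sum_congr rfl fun i _ => ?_
      rw [map_mul, Module.End.mul_apply, rep_diagonal_delta, map_smul]
    have h4 := Fintype.linearIndependent_iff.1 (linearIndependent_rep_delta (c := c) hcard hg) _ hsum i
    rw [if_neg hi, sub_zero] at h4
    exact (IsFractionRing.injective (MvPolynomial (Fin (ht ν)) K) (Rat K (ht ν)))
      (by rw [h4, map_zero])
  rw [Finset.sum_eq_single i₀, h1, one_mul]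
  · intro i _ hi
    rw [show f i = 0 from funext fun c => key c i hi, map_zero, mul_zero]
  · simp

/-- The center of `R(ν)` consists of the compatible families of polynomials. -/
theorem diagonal_central_iff (f : Seq ν → MvPolynomial (Fin (ht ν)) K) :
    (∀ a, a * diagonal K D ν f = diagonal K D ν f * a) ↔
      ∀ k hk s, rename (adj k hk) (f (s.swap k hk)) = f s := by
  constructor
  · intro hz k hk c
    -- Both sides send the delta function at 1 to a function whose value at s_k is the same nonzero
    -- crossing coefficient times a polynomial. Cancelling it leaves the compatibility.
    have h := congrArg (fun a => rep K D c a (delta K ν 1) (adj k hk)) (hz (tau K D ν k))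
    simp only [map_mul (rep K D c), Module.End.mul_apply, rep_diagonal] at h
    rw [rep_diagonal_delta, map_smul, rep_tau k hk, Pi.smul_apply, smul_eq_mul] at h
    have h2 : opT K D c k hk (delta K ν 1) (adj k hk) ≠ 0 := by
      have h3 : adj k hk ≠ 1 := by
        rw [Ne, Equiv.Perm.one_def, Equiv.swap_eq_refl_iff]
        simp
      have h4 : delta K ν 1 (adj k hk) = 0 := Pi.single_eq_of_ne h3 _
      have h5 : delta K ν (adj k hk) (adj k hk) = 1 := Pi.single_eq_same _ _
      rw [opT_delta, one_mul, Pi.add_apply, Pi.smul_apply, Pi.smul_apply, h4, h5, smul_zero,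
        zero_add, smul_eq_mul, mul_one]
      exact crossCoeff_ne_zero (by simp)
    exact (IsFractionRing.injective (MvPolynomial (Fin (ht ν)) K) (Rat K (ht ν))
      (mul_right_cancel₀ h2 h)).symm
  · intro hf a
    have hcross (k : ℕ) (hk : k + 1 < ht ν) (s : Seq ν) :
        crossing K D k hk s * diagonal K D ν f = diagonal K D ν f * crossing K D k hk s := by
      have e1 : crossing K D k hk s * diagonal K D ν f =
          crossing K D k hk s * evalDots K D ν (f s) := by
        rw [← crossing_mul, mul_assoc, idem_mul_diagonal, mul_assoc, (commute_evalDots_idem _ s).eq]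
      have e2 : diagonal K D ν f * crossing K D k hk s =
          evalDots K D ν (f (s.swap k hk)) * crossing K D k hk s := by
        rw [← mul_crossing, ← mul_assoc, diagonal_mul_idem, mul_assoc]
      have e3 : rename (adj k hk) (f s) = f (s.swap k hk) := by
        have := hf k hk (s.swap k hk)
        rwa [Seq.swap_swap] at this
      rw [e1, e2]
      by_cases h : s.1 ⟨k, by omega⟩ = s.1 ⟨k + 1, hk⟩ ∧
          D.a (s.1 ⟨k, by omega⟩) (s.1 ⟨k, by omega⟩) = 2
      · obtain ⟨q, hq, hq'⟩ := slide_real (K := K) k hk s h.1 h.2 (f s)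
        -- The sequence is fixed by the exchange, so compatibility says that the polynomial is
        -- symmetric in the two variables and its divided difference is zero.
        rw [e3, Seq.swap_eq_self h.1, sub_self] at hq'
        have hX : (X ⟨k, by omega⟩ - X ⟨k + 1, hk⟩ : MvPolynomial (Fin (ht ν)) K) ≠ 0 :=
          sub_ne_zero.2 ((X_injective).ne (by simp))
        rw [hq, (mul_eq_zero.1 hq').resolve_left hX, map_zero, zero_mul, add_zero, e3]
      · rw [slide_other k hk s h, e3]
    obtain ⟨x, rfl⟩ := RingQuot.mkAlgHom_surjective K (Rel K D ν) a
    induction x using FreeAlgebra.induction with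
    | grade0 r => rw [AlgHom.commutes]; exact Algebra.commutes _ _
    | grade1 y =>
      cases y with
      | idem s =>
        change idem K D s * _ = _ * idem K D s
        rw [idem_mul_diagonal, diagonal_mul_idem]
      | dot k s =>
        change gen K D ν (.dot k s) * _ = _ * gen K D ν (.dot k s)
        rw [← dot_mul_idem, ← evalDots_X, ← diagonal_single, ← map_mul, ← map_mul, mul_comm]
      | cross k hk s => exact hcross k hk s
    | mul x y hx hy => rw [map_mul, mul_assoc, hy, ← mul_assoc, hx, mul_assoc]
    | add x y hx hy => rw [map_add, add_mul, mul_add, hx, hy]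

end Center

/-! ### Tensor products of symmetric polynomials as invariants -/

section Tensor

open MvPolynomial Equiv

variable {K : Type*} [Field K] {t : ℕ} {m : Fin t → ℕ}

/-- A family of exponents as one exponent on the disjoint union. -/
noncomputable def joinExp (q : ∀ k, Fin (m k) →₀ ℕ) : (Σ k, Fin (m k)) →₀ ℕ :=
  Finsupp.sigmaFinsuppEquivPiFinsupp.symm q

theorem joinExp_apply (q : ∀ k, Fin (m k) →₀ ℕ) (x : Σ k, Fin (m k)) :
    joinExp q x = q x.1 x.2 := by
  rw [joinExp, ← Finsupp.sigmaFinsuppEquivPiFinsupp_apply, Equiv.apply_symm_apply]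

theorem joinExp_injective : Function.Injective (joinExp (m := m)) :=
  Finsupp.sigmaFinsuppEquivPiFinsupp.symm.injective

theorem joinExp_surjective : Function.Surjective (joinExp (m := m)) :=
  Finsupp.sigmaFinsuppEquivPiFinsupp.symm.surjective

theorem joinExp_eq_sum (q : ∀ k, Fin (m k) →₀ ℕ) :
    joinExp q = ∑ k, (q k).mapDomain (Sigma.mk k) := by
  ext ⟨k, i⟩
  rw [joinExp_apply, Finsupp.finsetSum_apply, Finset.sum_eq_single k]
  · rw [Finsupp.mapDomain_apply sigma_mk_injective]
  · intro l _ hl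
    rw [Finsupp.mapDomain_of_notMem_range]
    rintro ⟨j, hj⟩
    exact hl (congrArg Sigma.fst hj)
  · simp

theorem joinExp_mapDomain (q : ∀ k, Fin (m k) →₀ ℕ) (σ : ∀ k, Perm (Fin (m k))) :
    joinExp (fun k => (q k).mapDomain (σ k)) = (joinExp q).mapDomain (Equiv.sigmaCongrRight σ) := by
  ext ⟨k, i⟩
  rw [joinExp_apply, Finsupp.mapDomain_equiv_apply, Finsupp.mapDomain_equiv_apply]
  simp [joinExp_apply]

variable (K m) in
/-- The product of polynomials in disjoint sets of variables. -/
noncomputable def joinPoly :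
    (⨂[K] k : Fin t, MvPolynomial (Fin (m k)) K) →ₗ[K] MvPolynomial (Σ k, Fin (m k)) K :=
  PiTensorProduct.lift ((MultilinearMap.mkPiAlgebra K (Fin t) _).compLinearMap
    fun k => (rename (R := K) (Sigma.mk (β := fun k => Fin (m k)) k)).toLinearMap)

theorem joinPoly_tprod (f : ∀ k, MvPolynomial (Fin (m k)) K) :
    joinPoly K m (PiTensorProduct.tprod K f) = ∏ k, rename (Sigma.mk k) (f k) := by
  simp [joinPoly]

/-- Joining carries the tensor basis of monomials bijectively to the monomials in all variables, so
coefficients are coordinates. Injectivity follows. -/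
theorem coeff_joinPoly (x : ⨂[K] k : Fin t, MvPolynomial (Fin (m k)) K)
    (q : ∀ k, Fin (m k) →₀ ℕ) : coeff (joinExp q) (joinPoly K m x) =
      (Basis.piTensorProduct fun k => basisMonomials (Fin (m k)) K).repr x q := by
  classical
  have h : lcoeff K (joinExp q) ∘ₗ joinPoly K m =
      (Basis.piTensorProduct fun k => basisMonomials (Fin (m k)) K).coord q := by
    refine (Basis.piTensorProduct fun k => basisMonomials (Fin (m k)) K).ext fun p => ?_
    rw [LinearMap.comp_apply, Basis.piTensorProduct_apply, joinPoly_tprod, ← Basis.piTensorProduct_apply,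
      Module.Basis.coord_apply, Module.Basis.repr_self, Finsupp.single_apply]
    simp only [coe_basisMonomials, rename_monomial]
    rw [← monomial_sum_one, ← joinExp_eq_sum, lcoeff_apply, coeff_monomial]
    exact if_congr joinExp_injective.eq_iff rfl rfl
  exact LinearMap.congr_fun h x

theorem coeff_joinPoly_tprod (f : ∀ k, MvPolynomial (Fin (m k)) K) (q : ∀ k, Fin (m k) →₀ ℕ) :
    coeff (joinExp q) (joinPoly K m (PiTensorProduct.tprod K f)) = ∏ k, coeff (q k) (f k) := by
  rw [coeff_joinPoly, Basis.piTensorProduct_repr_tprod_apply]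
  rfl

theorem joinPoly_injective : Function.Injective (joinPoly K m) := by
  rw [injective_iff_map_eq_zero]
  intro x hx
  apply (Basis.piTensorProduct fun k => basisMonomials (Fin (m k)) K).repr.injective
  ext q
  rw [← coeff_joinPoly, hx, map_zero]
  rfl

variable (K m) in
/-- The product of symmetric polynomials in disjoint sets of variables. -/
noncomputable def joinSym : SymTensor K m →ₐ[K] MvPolynomial (Σ k, Fin (m k)) K :=
  PiTensorProduct.liftAlgHom ((MultilinearMap.mkPiAlgebra K (Fin t) _).compLinearMap
    fun k => ((rename (Sigma.mk k)).comp (symmetricSubalgebra (Fin (m k)) K).val).toLinearMap)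
    (by simp) (by intro x y; simp [Finset.prod_mul_distrib])

theorem joinSym_tprod (f : ∀ k, symmetricSubalgebra (Fin (m k)) K) :
    joinSym K m (PiTensorProduct.tprod K f) =
      ∏ k, rename (Sigma.mk k) (f k : MvPolynomial (Fin (m k)) K) := by
  simp [joinSym]

theorem joinSym_eq (x : SymTensor K m) : joinSym K m x = joinPoly K m (PiTensorProduct.map
    (fun k => (symmetricSubalgebra (Fin (m k)) K).val.toLinearMap) x) := by
  induction x using PiTensorProduct.induction_on with
  | smul_tprod r f =>
    rw [map_smul, map_smul, map_smul, joinSym_tprod, PiTensorProduct.map_tprod, joinPoly_tprod]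
    rfl
  | add x y hx hy => simp only [map_add, hx, hy]

/-- Over a field each inclusion of symmetric polynomials has a linear retraction. The tensor product
of the inclusions is therefore still injective. -/
theorem joinSym_injective : Function.Injective (joinSym K m) := by
  have h1 (k : Fin t) : ∃ r : MvPolynomial (Fin (m k)) K →ₗ[K] symmetricSubalgebra (Fin (m k)) K,
      r ∘ₗ (symmetricSubalgebra (Fin (m k)) K).val.toLinearMap = LinearMap.id :=
    LinearMap.exists_leftInverse_of_injective _
      (LinearMap.ker_eq_bot.2 Subtype.val_injective)
  choose r hr using h1
  have h2 : Function.LeftInverse (PiTensorProduct.map r) (PiTensorProduct.map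
      fun k => (symmetricSubalgebra (Fin (m k)) K).val.toLinearMap) := by
    intro x
    rw [← LinearMap.comp_apply, ← PiTensorProduct.map_comp]
    simp only [hr, PiTensorProduct.map_id, LinearMap.id_apply]
  intro x y h
  rw [joinSym_eq, joinSym_eq] at h
  exact h2.injective (joinPoly_injective h)

/-- Polynomials invariant under permutations within each set of variables. -/
def IsInvariant (g : MvPolynomial (Σ k, Fin (m k)) K) : Prop :=
  ∀ σ : ∀ k, Perm (Fin (m k)), rename (Equiv.sigmaCongrRight σ) g = g

theorem isInvariant_joinSym (x : SymTensor K m) : IsInvariant (joinSym K m x) := by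
  intro σ
  induction x using PiTensorProduct.induction_on with
  | smul_tprod r f =>
    rw [map_smul, map_smul, joinSym_tprod, map_prod]
    congr 1
    refine Finset.prod_congr rfl fun k _ => ?_
    have h := (f k).2 (σ k)
    conv_rhs => rw [← h]
    rw [rename_rename, rename_rename]
    rfl
  | add x y hx hy => rw [map_add, map_add, hx, hy]

variable (K) in
/-- The sum of the monomials in the orbit of an exponent. -/
noncomputable def orbitSum {n : ℕ} (q : Fin n →₀ ℕ) : symmetricSubalgebra (Fin n) K :=
  -- The sum runs over the set of exponents in the orbit, not over permutations. Each coefficient is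
  -- then 1, whatever the stabiliser and the characteristic.
  ⟨∑ p ∈ Finset.univ.image fun σ : Perm (Fin n) => q.mapDomain σ, monomial p 1, by
    intro e
    rw [map_sum]
    simp only [rename_monomial]
    refine Finset.sum_bij (fun p _ => p.mapDomain e) ?_ ?_ ?_ fun _ _ => rfl
    · intro p hp
      obtain ⟨σ, -, rfl⟩ := Finset.mem_image.1 hp
      refine Finset.mem_image.2 ⟨e * σ, Finset.mem_univ _, ?_⟩
      rw [← Finsupp.mapDomain_comp]
      rfl
    · exact fun _ _ _ _ h => Finsupp.mapDomain_injective e.injective h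
    · intro p hp
      obtain ⟨σ, -, rfl⟩ := Finset.mem_image.1 hp
      refine ⟨q.mapDomain (e⁻¹ * σ : Perm (Fin n)), Finset.mem_image.2 ⟨_, Finset.mem_univ _, rfl⟩, ?_⟩
      rw [← Finsupp.mapDomain_comp]
      congr 1
      funext i
      simp⟩

theorem coeff_orbitSum {n : ℕ} (q p : Fin n →₀ ℕ) [Decidable (∃ σ : Perm (Fin n), q.mapDomain σ = p)] :
    coeff p (orbitSum K q : MvPolynomial (Fin n) K) =
      if ∃ σ : Perm (Fin n), q.mapDomain σ = p then 1 else 0 := by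
  rw [orbitSum]
  simp only [coeff_sum, coeff_monomial, Finset.sum_ite_eq']
  simp

theorem isHomogeneous_orbitSum {n : ℕ} (q : Fin n →₀ ℕ) :
    (orbitSum K q : MvPolynomial (Fin n) K).IsHomogeneous (∑ i, q i) := by
  classical
  intro p hp
  rw [coeff_orbitSum] at hp
  obtain ⟨σ, rfl⟩ : ∃ σ : Perm (Fin n), q.mapDomain σ = p := by
    by_contra h
    exact hp (if_neg h)
  rw [Finsupp.weight_eq_sum]
  simp only [Finsupp.mapDomain_equiv_apply, Pi.one_apply, smul_eq_mul, mul_one]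
  exact Equiv.sum_comp σ.symm q

/-- Invariant polynomials are combinations of products of orbit sums. -/
theorem exists_joinSym (N : Submodule K (SymTensor K m)) (g : MvPolynomial (Σ k, Fin (m k)) K)
    (hg : IsInvariant g) (hN : ∀ q, coeff (joinExp q) g ≠ 0 →
      PiTensorProduct.tprod K (fun k => orbitSum K (q k)) ∈ N) : ∃ x ∈ N, joinSym K m x = g := by
  classical
  -- Subtracting a multiple of one product of orbit sums removes a whole orbit from the support and
  -- creates no new monomials. The submodule `N` records which products are used, so that degrees
  -- can be controlled.
  induction h : g.support.card using Nat.strong_induction_on generalizing g with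
  | _ n ih =>
  by_cases h0 : g = 0
  · exact ⟨0, zero_mem _, by rw [h0, map_zero]⟩
  obtain ⟨e, he⟩ := (support_nonempty.2 h0)
  obtain ⟨q, rfl⟩ := joinExp_surjective e
  have hcoeff (p : ∀ k, Fin (m k) →₀ ℕ) : coeff (joinExp p)
      (joinSym K m (PiTensorProduct.tprod K fun k => orbitSum K (q k))) =
      if ∀ k, ∃ σ : Perm (Fin (m k)), (q k).mapDomain σ = p k then 1 else 0 := by
    rw [joinSym_tprod, ← joinPoly_tprod, coeff_joinPoly_tprod]
    simp only [coeff_orbitSum]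
    rw [Fintype.prod_ite_zero]
    simp
  have hcoeff' (p : ∀ k, Fin (m k) →₀ ℕ)
      (hp : ∀ k, ∃ σ : Perm (Fin (m k)), (q k).mapDomain σ = p k) :
      coeff (joinExp p) g = coeff (joinExp q) g := by
    choose σ hσ using hp
    obtain rfl : (fun k => (q k).mapDomain (σ k)) = p := funext hσ
    rw [joinExp_mapDomain]
    conv_lhs => rw [← hg σ]
    rw [coeff_rename_mapDomain _ (Equiv.injective _)]
  set u := joinSym K m (PiTensorProduct.tprod K fun k => orbitSum K (q k)) with hu
  have hsub (p : ∀ k, Fin (m k) →₀ ℕ) (hp : coeff (joinExp p) (g - coeff (joinExp q) g • u) ≠ 0) :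
      coeff (joinExp p) g ≠ 0 ∧ p ≠ q := by
    rw [coeff_sub, coeff_smul, hcoeff] at hp
    split_ifs at hp with h1
    · rw [hcoeff' p h1] at hp
      simp at hp
    · refine ⟨by simpa using hp, ?_⟩
      rintro rfl
      exact h1 fun k => ⟨1, by simp⟩
  have hcard : (g - coeff (joinExp q) g • u).support.card < n := by
    rw [← h]
    refine Finset.card_lt_card ((Finset.ssubset_iff_of_subset fun e' he' => ?_).2
      ⟨joinExp q, he, fun h' => ?_⟩)
    · obtain ⟨p, rfl⟩ := joinExp_surjective e'
      exact mem_support_iff.2 (hsub p (mem_support_iff.1 he')).1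
    · exact (hsub q (mem_support_iff.1 h')).2 rfl
  have hinv : IsInvariant (g - coeff (joinExp q) g • u) := by
    intro σ
    rw [map_sub, map_smul, hg σ, hu, isInvariant_joinSym]
  obtain ⟨x, hx, hxg⟩ := ih _ hcard _ hinv (fun p hp => hN p (hsub p hp).1) rfl
  refine ⟨x + coeff (joinExp q) g • PiTensorProduct.tprod K fun k => orbitSum K (q k),
    add_mem hx (N.smul_mem _ (hN q (mem_support_iff.1 he))), ?_⟩
  rw [map_add, map_smul, hxg, ← hu, sub_add_cancel]

variable (w : Fin t → ℤ)

theorem weight_joinExp (q : ∀ k, Fin (m k) →₀ ℕ) :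
    Finsupp.weight (fun x : Σ k, Fin (m k) => w x.1) (joinExp q) =
      ∑ k, w k * ((∑ i, q k i : ℕ) : ℤ) := by
  rw [Finsupp.weight_eq_sum, Fintype.sum_sigma]
  refine Finset.sum_congr rfl fun k _ => ?_
  simp [joinExp_apply, Finset.mul_sum, mul_comm]

/-- The grading of the tensor product is the weighted grading of polynomials. -/
theorem mem_symTensor_homogeneousPart_iff (d : ℤ) (x : SymTensor K m) :
    x ∈ SymTensor.homogeneousPart K m w d ↔
      IsWeightedHomogeneous (fun y : Σ k, Fin (m k) => w y.1) (joinSym K m x) d := by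
  constructor
  · intro hx
    rw [← mem_weightedHomogeneousSubmodule]
    induction hx using Submodule.span_induction with
    | mem x hx =>
      obtain ⟨f, p, hf, hd, rfl⟩ := hx
      rw [mem_weightedHomogeneousSubmodule]
      intro e he
      obtain ⟨q, rfl⟩ := joinExp_surjective e
      rw [joinSym_tprod, ← joinPoly_tprod, coeff_joinPoly_tprod, Finset.prod_ne_zero_iff] at he
      rw [weight_joinExp, ← hd]
      refine Finset.sum_congr rfl fun k _ => ?_
      have := hf k (he k (Finset.mem_univ _))
      rw [Finsupp.weight_eq_sum] at this
      simp only [Pi.one_apply, smul_eq_mul, mul_one] at this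
      rw [this]
    | zero => rw [map_zero]; exact zero_mem _
    | add x y _ _ hx hy => rw [map_add]; exact add_mem hx hy
    | smul r x _ hx => rw [map_smul]; exact Submodule.smul_mem _ r hx
  · intro hx
    -- The image of `x` is rebuilt from products of orbit sums of degree `d`. Injectivity identifies
    -- the result with `x`.
    obtain ⟨y, hy, hxy⟩ := exists_joinSym (SymTensor.homogeneousPart K m w d) _
      (isInvariant_joinSym x) fun q hq => Submodule.subset_span
        ⟨_, fun k => ∑ i, q k i, fun k => isHomogeneous_orbitSum (q k), by
          rw [← hx hq, weight_joinExp], rfl⟩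
    rwa [← joinSym_injective hxy]

end Tensor

/-! ### The grading via a coaction -/

section Grading

open MvPolynomial Equiv

variable {K : Type*} [Field K] {I : Type*} [DecidableEq I] [Fintype I]
  {D : BorcherdsCartanDatum I} {ν : I → ℕ}

variable (K D ν) in
/-- The coaction of the grading on the free algebra. -/
noncomputable def freeCoaction : FreeAlgebra K (Gen ν) →ₐ[K] AddMonoidAlgebra (R K D ν) ℤ :=
  FreeAlgebra.lift K fun g => AddMonoidAlgebra.single (g.deg D) (gen K D ν g)

variable (D) in
/-- An element of the free algebra on which the coaction is homogeneous of degree `d`. -/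
def IsHomog (x : FreeAlgebra K (Gen ν)) (d : ℤ) : Prop :=
  freeCoaction K D ν x = AddMonoidAlgebra.single d (RingQuot.mkAlgHom K (Rel K D ν) x)

namespace IsHomog

variable {x y : FreeAlgebra K (Gen ν)} {d e : ℤ}

theorem mul (hx : IsHomog D x d) (hy : IsHomog D y e) : IsHomog D (x * y) (d + e) := by
  rw [IsHomog, map_mul, map_mul, hx, hy, AddMonoidAlgebra.single_mul_single]

theorem add (hx : IsHomog D x d) (hy : IsHomog D y d) : IsHomog D (x + y) d := by
  rw [IsHomog, map_add, map_add, hx, hy, AddMonoidAlgebra.single_add]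

theorem zero (d : ℤ) : IsHomog D (0 : FreeAlgebra K (Gen ν)) d := by
  rw [IsHomog, map_zero, map_zero, AddMonoidAlgebra.single_zero]

theorem one : IsHomog D (1 : FreeAlgebra K (Gen ν)) 0 := by
  rw [IsHomog, map_one, map_one, AddMonoidAlgebra.one_def]

theorem pow (hx : IsHomog D x d) (n : ℕ) : IsHomog D (x ^ n) (n * d) := by
  induction n with
  | zero => simpa using one
  | succ n ih =>
    rw [pow_succ]
    convert ih.mul hx using 1
    push_cast; ring

theorem sum {ι : Type*} {s : Finset ι} {f : ι → FreeAlgebra K (Gen ν)}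
    (h : ∀ i ∈ s, IsHomog D (f i) d) : IsHomog D (∑ i ∈ s, f i) d := by
  classical
  induction s using Finset.induction_on with
  | empty => simpa using zero d
  | insert i s hi ih =>
    rw [Finset.sum_insert hi]
    exact (h i (by simp)).add (ih fun j hj => h j (by simp [hj]))

theorem congr (hx : IsHomog D x d) (h : d = e) : IsHomog D x e := h ▸ hx

theorem idem (s : Seq ν) : IsHomog D (fe K s) 0 := by
  rw [IsHomog, freeCoaction, fe, FreeAlgebra.lift_ι_apply]; rfl

theorem dot (k : ℕ) (hk : k < ht ν) (s : Seq ν) :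
    IsHomog D (fx K k hk s) (2 * D.r (s.1 ⟨k, hk⟩)) := by
  rw [IsHomog, freeCoaction, fx, FreeAlgebra.lift_ι_apply]; rfl

theorem cross (k : ℕ) (hk : k + 1 < ht ν) (s : Seq ν) :
    IsHomog D (ft K k hk s) (-D.form (s.1 ⟨k, by omega⟩) (s.1 ⟨k + 1, hk⟩)) := by
  rw [IsHomog, freeCoaction, ft, FreeAlgebra.lift_ι_apply]; rfl

theorem of_rel (h : ∃ d, IsHomog D x d ∧ IsHomog D y d) (hr : Rel K D ν x y) :
    freeCoaction K D ν x = freeCoaction K D ν y := by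
  obtain ⟨d, hx, hy⟩ := h
  rw [hx, hy, mk_rel hr]

end IsHomog

/-- Both sides of each relation have a common degree. This makes the coaction descend to the
quotient. -/
theorem exists_isHomog_of_rel {x y : FreeAlgebra K (Gen ν)} (h : Rel K D ν x y) :
    ∃ d, IsHomog D x d ∧ IsHomog D y d := by
  have e1 (k : ℕ) (hk : k + 2 < ht ν) :
      adj k (by omega) (⟨k + 1 + 1, hk⟩ : Fin (ht ν)) = ⟨k + 2, hk⟩ :=
    swap_apply_of_ne_of_ne (by simp; omega) (by simp)
  have e2 (k : ℕ) (hk : k + 2 < ht ν) :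
      adj (k + 1) (by omega) (⟨k, by omega⟩ : Fin (ht ν)) = ⟨k, by omega⟩ :=
    swap_apply_of_ne_of_ne (by simp) (by simp; omega)
  have e3 (k : ℕ) (hk : k + 2 < ht ν) :
      adj (k + 1) hk (⟨k + 2, by omega⟩ : Fin (ht ν)) = ⟨k + 1, by omega⟩ := swap_apply_right _ _
  have hc : ∀ i j, D.form i j = D.form j i := form_comm
  induction h with
  | idem_self s => exact ⟨0, (IsHomog.idem s).mul (.idem s), .idem s⟩
  | idem_ne s t h => exact ⟨0, (IsHomog.idem s).mul (.idem t), .zero _⟩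
  | idem_sum => exact ⟨0, .sum fun s _ => .idem s, .one⟩
  | dot_top k hk s =>
    exact ⟨_, ((IsHomog.idem s).mul (.dot k hk s)).congr (zero_add _), .dot k hk s⟩
  | dot_bot k hk s =>
    exact ⟨_, ((IsHomog.dot k hk s).mul (.idem s)).congr (add_zero _), .dot k hk s⟩
  | cross_top k hk s =>
    exact ⟨_, ((IsHomog.idem _).mul (.cross k hk s)).congr (zero_add _), .cross k hk s⟩
  | cross_bot k hk s =>
    exact ⟨_, ((IsHomog.cross k hk s).mul (.idem _)).congr (add_zero _), .cross k hk s⟩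
  | dot_dot k l hk hl s =>
    exact ⟨_, ((IsHomog.dot k hk s).mul (.dot l hl s)).congr (add_comm _ _),
      (IsHomog.dot l hl s).mul (.dot k hk s)⟩
  | dot_cross k l hk hl h h' s =>
    refine ⟨_, ((IsHomog.dot l hl _).mul (.cross k hk s)).congr ?_,
      (IsHomog.cross k hk s).mul (.dot l hl s)⟩
    rw [Seq.swap_apply, swap_apply_of_ne_of_ne (by simpa using h) (by simpa using h'), add_comm]
  | cross_cross k l hk hl h s =>
    refine ⟨_, ((IsHomog.cross k hk _).mul (.cross l hl s)).congr ?_,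
      (IsHomog.cross l hl _).mul (.cross k hk s)⟩
    simp only [Seq.swap_apply]
    rw [swap_apply_of_ne_of_ne (x := (⟨k, by omega⟩ : Fin (ht ν))) (by simp; omega) (by simp; omega),
      swap_apply_of_ne_of_ne (x := (⟨k + 1, by omega⟩ : Fin (ht ν))) (by simp; omega) (by simp; omega),
      swap_apply_of_ne_of_ne (x := (⟨l, by omega⟩ : Fin (ht ν))) (by simp; omega) (by simp; omega),
      swap_apply_of_ne_of_ne (x := (⟨l + 1, by omega⟩ : Fin (ht ν))) (by simp; omega) (by simp; omega),
      add_comm]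
  | sq_eq k hk s i h₀ h₁ => exact ⟨_, (IsHomog.cross k hk _).mul (.cross k hk s), .zero _⟩
  | sq_orth k hk s i j h₀ h₁ hij hf =>
    refine ⟨0, ((IsHomog.cross k hk _).mul (.cross k hk s)).congr ?_, .idem s⟩
    simp only [Seq.swap_apply, swap_apply_left, swap_apply_right, h₀, h₁, hc j i, hf]
    rfl
  | sq_edge k hk s i j h₀ h₁ hij hf =>
    refine ⟨-(2 * D.form i j), ((IsHomog.cross k hk _).mul (.cross k hk s)).congr ?_,
      (((IsHomog.dot k _ s).pow _).congr ?_).add (((IsHomog.dot (k + 1) hk s).pow _).congr ?_)⟩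
    · simp only [Seq.swap_apply, swap_apply_left, swap_apply_right, h₀, h₁, hc j i]
      ring
    · rw [Int.toNat_of_nonneg (by have := D.off_diag i j hij; omega), h₀, BorcherdsCartanDatum.form]
      ring
    · rw [Int.toNat_of_nonneg (by have := D.off_diag j i hij.symm; omega), h₁, hc,
        BorcherdsCartanDatum.form]
      ring
  | slide_real_left k hk s i h₀ h₁ hi =>
    have hii : D.form i i = 2 * D.r i := by rw [BorcherdsCartanDatum.form, hi]; ring
    refine ⟨0, ((IsHomog.dot k _ _).mul (.cross k hk s)).congr ?_,
      (((IsHomog.cross k hk s).mul (.dot (k + 1) hk s)).congr ?_).add (.idem s)⟩ <;>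
    simp only [Seq.swap_apply, swap_apply_left, h₀, h₁, hii] <;> ring
  | slide_real_right k hk s i h₀ h₁ hi =>
    have hii : D.form i i = 2 * D.r i := by rw [BorcherdsCartanDatum.form, hi]; ring
    refine ⟨0, ((IsHomog.cross k hk s).mul (.dot k _ s)).congr ?_,
      (((IsHomog.dot (k + 1) hk _).mul (.cross k hk s)).congr ?_).add (.idem s)⟩ <;>
    simp only [Seq.swap_apply, swap_apply_right, h₀, h₁, hii] <;> ring
  | slide_left k hk s i j h₀ h₁ hij =>
    refine ⟨_, ((IsHomog.dot k _ _).mul (.cross k hk s)).congr ?_,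
      (IsHomog.cross k hk s).mul (.dot (k + 1) hk s)⟩
    simp only [Seq.swap_apply, swap_apply_left]
    ring
  | slide_right k hk s i j h₀ h₁ hij =>
    refine ⟨_, ((IsHomog.cross k hk s).mul (.dot k _ s)).congr ?_,
      (IsHomog.dot (k + 1) hk _).mul (.cross k hk s)⟩
    simp only [Seq.swap_apply, swap_apply_right]
    ring
  | braid_real k hk s i j h₀ h₁ h₂ hi hij hf =>
    refine ⟨-(D.form i j + D.form i i + D.form i j),
      (((IsHomog.cross k _ _).mul (.cross (k + 1) hk _)).mul (.cross k _ s)).congr ?_,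
      ((((IsHomog.cross (k + 1) _ _).mul (.cross k _ _)).mul (.cross (k + 1) _ s)).congr ?_).add
        (.sum fun c hcr => ((((IsHomog.dot k _ s).pow c).mul ((IsHomog.dot (k + 2) hk s).pow _)).mul
          (.idem s)).congr ?_)⟩
    · simp only [Seq.swap_apply, swap_apply_left, swap_apply_right, e1 k hk, e2 k hk, h₀, h₁,
        h₂, hc j i]
      ring
    · simp only [Seq.swap_apply, swap_apply_left, swap_apply_right, e1 k hk, e2 k hk, e3 k hk, h₀, h₁,
        h₂, hc j i]
      ring
    · rw [h₀, h₂]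
      have h1 := D.off_diag i j hij
      have h2 := Finset.mem_range.1 hcr
      -- The truncated subtraction is exact since c is below the bound. The total degree of each
      -- term is then independent of c.
      have h3 : (((-D.a i j).toNat - 1 - c : ℕ) : ℤ) = -D.a i j - 1 - c := by omega
      rw [h3, BorcherdsCartanDatum.form, BorcherdsCartanDatum.form, hi]
      ring
  | braid k hk s i j l h₀ h₁ h₂ h =>
    refine ⟨_, (((IsHomog.cross k _ _).mul (.cross (k + 1) hk _)).mul (.cross k _ s)).congr ?_,
      ((IsHomog.cross (k + 1) _ _).mul (.cross k _ _)).mul (.cross (k + 1) _ s)⟩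
    simp only [Seq.swap_apply, swap_apply_left, swap_apply_right, e1 k hk, e2 k hk, e3 k hk]
    ring

variable (K D ν) in
/-- The coaction of the grading on `R(ν)`. -/
noncomputable def coaction : R K D ν →ₐ[K] AddMonoidAlgebra (R K D ν) ℤ :=
  RingQuot.liftAlgHom K ⟨freeCoaction K D ν, fun _ _ h => IsHomog.of_rel (exists_isHomog_of_rel h) h⟩

/-- The homogeneous parts are only defined as spans. The coaction marks each by its own power of the
grading variable, so it separates distinct degrees. -/
theorem coaction_of_mem {d : ℤ} {z : R K D ν} (hz : z ∈ homogeneousPart K D ν d) :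
    coaction K D ν z = AddMonoidAlgebra.single d z := by
  induction hz using Submodule.span_induction with
  | mem z hz =>
    obtain ⟨l, hd, rfl⟩ := hz
    subst hd
    induction l with
    | nil =>
      simp only [List.map_nil, List.prod_nil, List.sum_nil, map_one]
      rw [AddMonoidAlgebra.one_def]
    | cons g l ih =>
      simp only [List.map_cons, List.prod_cons, List.sum_cons, map_mul]
      rw [ih, coaction, gen, RingQuot.liftAlgHom_mkAlgHom_apply, freeCoaction,
        FreeAlgebra.lift_ι_apply, AddMonoidAlgebra.single_mul_single]
      rfl
  | zero => rw [map_zero, AddMonoidAlgebra.single_zero]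
  | add x y _ _ hx hy => rw [map_add, hx, hy, AddMonoidAlgebra.single_add]
  | smul r x _ hx => rw [map_smul, hx, AddMonoidAlgebra.smul_single]

theorem mul_mem_homogeneousPart {d e : ℤ} {x y : R K D ν} (hx : x ∈ homogeneousPart K D ν d)
    (hy : y ∈ homogeneousPart K D ν e) : x * y ∈ homogeneousPart K D ν (d + e) := by
  induction hx using Submodule.span_induction with
  | mem x hx =>
    refine mul_span_mem ?_ hy
    rintro _ ⟨l, rfl, rfl⟩
    obtain ⟨l', rfl, rfl⟩ := hx
    exact Submodule.subset_span ⟨l' ++ l, by simp, by simp⟩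
  | zero => rw [zero_mul]; exact zero_mem _
  | add x z _ _ hx hz => rw [add_mul]; exact add_mem hx hz
  | smul r x _ hx => rw [smul_mul_assoc]; exact Submodule.smul_mem _ r hx

theorem gen_mem_homogeneousPart (g : Gen ν) : gen K D ν g ∈ homogeneousPart K D ν (g.deg D) :=
  Submodule.subset_span ⟨[g], by simp, by simp⟩

/-- The degrees of the dots. -/
def dotWeight (D : BorcherdsCartanDatum I) (s : Seq ν) (k : Fin (ht ν)) : ℤ := 2 * D.r (s.1 k)

theorem monomial_mem_homogeneousPart (s : Seq ν) (e : Fin (ht ν) →₀ ℕ) :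
    evalDots K D ν (monomial e 1) * idem K D s ∈
      homogeneousPart K D ν (Finsupp.weight (dotWeight D s) e) := by
  have hmul (p q : MvPolynomial (Fin (ht ν)) K) : evalDots K D ν (p * q) * idem K D s =
      (evalDots K D ν p * idem K D s) * (evalDots K D ν q * idem K D s) := by
    rw [mul_assoc, ← mul_assoc (idem K D s), ← (commute_evalDots_idem q s).eq, mul_assoc _ _ (idem K D s),
      idem_mul_self, map_mul, mul_assoc]
  have hidem : idem K D s ∈ homogeneousPart K D ν 0 := gen_mem_homogeneousPart (.idem s)
  induction e using Finsupp.induction_linear with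
  | zero => simpa using hidem
  | add e e' he he' =>
    rw [map_add, ← mul_one (1 : K), ← monomial_mul, hmul]
    exact mul_mem_homogeneousPart he he'
  | single k n =>
    induction n with
    | zero => simpa using hidem
    | succ n ih =>
      rw [Finsupp.single_add, map_add, ← mul_one (1 : K), ← monomial_mul, hmul]
      refine mul_mem_homogeneousPart ih ?_
      have hX : monomial (Finsupp.single k 1) 1 = (X k : MvPolynomial (Fin (ht ν)) K) := rfl
      rw [hX, evalDots_X, dot_mul_idem, Finsupp.weight_single, one_smul]
      exact gen_mem_homogeneousPart (.dot k s)

theorem diagonal_mem_homogeneousPart {f : Seq ν → MvPolynomial (Fin (ht ν)) K} {d : ℤ}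
    (hf : ∀ s, IsWeightedHomogeneous (dotWeight D s) (f s) d) :
    diagonal K D ν f ∈ homogeneousPart K D ν d := by
  rw [diagonal_apply]
  refine sum_mem fun s _ => ?_
  rw [(f s).as_sum, map_sum, Finset.sum_mul]
  refine sum_mem fun e he => ?_
  rw [show monomial e (coeff e (f s)) = coeff e (f s) • monomial e 1 by
    rw [smul_monomial, smul_eq_mul, mul_one], map_smul, smul_mul_assoc,
    ← hf s (mem_support_iff.1 he)]
  exact Submodule.smul_mem _ _ (monomial_mem_homogeneousPart s e)

/-- The weighted components of the family give elements of known degrees. Comparing their coactions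
with that of the sum shows that components of other degrees map to zero, and `diagonal` is
injective. -/
theorem diagonal_mem_homogeneousPart_iff {f : Seq ν → MvPolynomial (Fin (ht ν)) K} {d : ℤ} :
    diagonal K D ν f ∈ homogeneousPart K D ν d ↔
      ∀ s, IsWeightedHomogeneous (dotWeight D s) (f s) d := by
  classical
  refine ⟨fun h => ?_, diagonal_mem_homogeneousPart⟩
  set F : ℤ → Seq ν → MvPolynomial (Fin (ht ν)) K :=
    fun e s => weightedHomogeneousComponent (dotWeight D s) e (f s) with hF
  -- All weights that occur in some member of the family, so that the decomposition into components
  -- is a finite sum.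
  set S : Finset ℤ := Finset.univ.biUnion fun s =>
    (f s).support.image (Finsupp.weight (dotWeight D s)) with hS
  have hsum : f = ∑ e ∈ S, F e := by
    funext s
    rw [Finset.sum_apply]
    simp only [hF, weightedHomogeneousComponent_apply]
    rw [Finset.sum_fiberwise_of_maps_to (fun e he => ?_), ← as_sum]
    exact Finset.mem_biUnion.2 ⟨s, Finset.mem_univ _, Finset.mem_image_of_mem _ he⟩
  have hmem (e : ℤ) : diagonal K D ν (F e) ∈ homogeneousPart K D ν e :=
    diagonal_mem_homogeneousPart fun s => weightedHomogeneousComponent_mem _ _ _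
  have h1 := coaction_of_mem h
  have h2 : coaction K D ν (diagonal K D ν f) =
      ∑ e ∈ S, AddMonoidAlgebra.single e (diagonal K D ν (F e)) := by
    conv_lhs => rw [hsum, map_sum, map_sum]
    exact Finset.sum_congr rfl fun e _ => coaction_of_mem (hmem e)
  have h3 (e : ℤ) (he : e ∈ S) (hed : e ≠ d) : F e = 0 := by
    apply diagonal_injective (D := D)
    -- Reads off the coefficient of degree `e` on both sides; the right side is concentrated in
    -- degree `d`.
    have h4 := congrArg (fun y => AddMonoidAlgebra.coeff y e) (h2.symm.trans h1)
    simp only [AddMonoidAlgebra.coeff_sum, AddMonoidAlgebra.coeff_single, Finsupp.finsetSum_apply,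
      Finsupp.single_apply, Finset.sum_ite_eq', he, hed.symm, if_true, if_false] at h4
    rw [h4, map_zero]
  intro s
  have h4 : f s = ∑ e ∈ S, F e s := by conv_lhs => rw [hsum, Finset.sum_apply]
  rw [h4, ← mem_weightedHomogeneousSubmodule]
  refine sum_mem fun e he => ?_
  by_cases hed : e = d
  · subst hed
    exact weightedHomogeneousComponent_mem _ _ _
  · rw [h3 e he hed]
    exact zero_mem _

end Grading

/-! ### Compatible families and invariant polynomials -/

section Main

open MvPolynomial Equiv

variable {K : Type*} [Field K] {I : Type*} [DecidableEq I] [Fintype I]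
  {D : BorcherdsCartanDatum I} {ν : I → ℕ} {t : ℕ} {i : Fin t → I} {m : Fin t → ℕ}

theorem card_sigma_eq (hν : ν = ∑ k, Pi.single (i k) (m k)) :
    Fintype.card (Σ k, Fin (m k)) = ht ν := by
  subst hν
  simp only [ht, Finset.sum_apply, Fintype.card_sigma, Fintype.card_fin]
  rw [Finset.sum_comm]
  exact Finset.sum_congr rfl fun k _ => by rw [Finset.sum_pi_single']; simp

/-- A family is recovered from one of its members, so at least one sequence has to exist. -/
theorem nonempty_seq (hν : ν = ∑ k, Pi.single (i k) (m k)) : Nonempty (Seq ν) := by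
  have e : Fin (ht ν) ≃ Σ k, Fin (m k) :=
    Fintype.equivOfCardEq (by rw [card_sigma_eq hν, Fintype.card_fin])
  refine ⟨fun p => i (e p).1, fun j => ?_⟩
  have h1 : (Finset.univ.filter fun p => i (e p).1 = j).card =
      (Finset.univ.filter fun x : Σ k, Fin (m k) => i x.1 = j).card :=
    Finset.card_equiv e (by simp)
  rw [h1, Finset.card_filter, Fintype.sum_sigma, hν, Finset.sum_apply]
  refine Finset.sum_congr rfl fun k _ => ?_
  simp [Pi.single_apply, eq_comm]

/-- A labelling of the positions of a sequence by the variables of the tensor product. -/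
theorem exists_labelling (hi : Function.Injective i) (hν : ν = ∑ k, Pi.single (i k) (m k))
    (s : Seq ν) : ∃ v : (Σ k, Fin (m k)) ≃ Fin (ht ν), ∀ x, s.1 (v x) = i x.1 := by
  have h (k : Fin t) : Nonempty (Fin (m k) ≃ {p // s.1 p = i k}) := by
    refine ⟨Fintype.equivOfCardEq ?_⟩
    rw [Fintype.card_fin, Fintype.card_subtype, s.2, hν, Finset.sum_apply, Finset.sum_eq_single k]
    · simp
    · intro l _ hl
      rw [Pi.single_eq_of_ne (hi.ne hl.symm)]
    · simp
  let e (k : Fin t) := (h k).some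
  refine ⟨Equiv.ofBijective (fun x => (e x.1 x.2).1) ⟨?_, ?_⟩, fun x => (e x.1 x.2).2⟩
  · rintro ⟨k, a⟩ ⟨l, b⟩ hab
    dsimp only at hab
    obtain rfl : k = l := hi (by rw [← (e k a).2, hab, (e l b).2])
    rw [(e k).injective (Subtype.ext hab)]
  · intro p
    obtain ⟨k, hk⟩ : ∃ k, s.1 p = i k := by
      by_contra! hcon
      have h1 : ν (s.1 p) = 0 := by
        rw [congrFun hν (s.1 p), Finset.sum_apply]
        exact Finset.sum_eq_zero fun k _ => Pi.single_eq_of_ne (hcon k) _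
      rw [← s.2, Finset.card_eq_zero] at h1
      exact Finset.notMem_empty p (h1 ▸ by simp)
    exact ⟨⟨k, (e k).symm ⟨p, hk⟩⟩, by simp⟩

/-- Every permutation is a product of adjacent transpositions. -/
theorem perm_induction {n : ℕ} {P : Perm (Fin n) → Prop} (one : P 1)
    (mul : ∀ σ τ, P σ → P τ → P (σ * τ))
    (adj : ∀ k (hk : k + 1 < n), P (Equiv.swap ⟨k, Nat.lt_of_succ_lt hk⟩ ⟨k + 1, hk⟩))
    (σ : Perm (Fin n)) : P σ := by
  cases n with
  | zero => rwa [Subsingleton.elim σ 1]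
  | succ n =>
    have hσ : σ ∈ Submonoid.closure (Set.range fun i : Fin n => swap i.castSucc i.succ) := by
      rw [Equiv.Perm.mclosure_swap_castSucc_succ]; trivial
    induction hσ using Submonoid.closure_induction with
    | mem σ hσ =>
      obtain ⟨k, rfl⟩ := hσ
      exact adj k.1 (by omega)
    | one => exact one
    | mul σ τ _ _ h1 h2 => exact mul σ τ h1 h2

/-- A permutation preserving the fibres is a family of permutations of the fibres. -/
theorem exists_sigmaCongrRight (σ : Perm (Σ k, Fin (m k))) (h : ∀ x, (σ x).1 = x.1) :
    ∃ τ : ∀ k, Perm (Fin (m k)), Equiv.sigmaCongrRight τ = σ := by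
  have h1 (k : Fin t) (j : Fin (m k)) : ∃ j', σ ⟨k, j⟩ = ⟨k, j'⟩ := by
    have := h ⟨k, j⟩
    obtain ⟨⟨k', j'⟩, hx⟩ : ∃ x, σ ⟨k, j⟩ = x := ⟨_, rfl⟩
    rw [hx] at this
    obtain rfl : k' = k := this
    exact ⟨j', hx⟩
  choose f hf using h1
  have hinj (k : Fin t) : Function.Injective (f k) := by
    intro a b hab
    have := σ.injective ((hf k a).trans ((congrArg (Sigma.mk k) hab).trans (hf k b).symm))
    exact eq_of_heq (Sigma.mk.inj_iff.1 this).2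
  refine ⟨fun k => Equiv.ofBijective (f k) (Finite.injective_iff_bijective.1 (hinj k)), ?_⟩
  ext1 ⟨k, j⟩
  rw [hf]
  rfl

theorem rename_rename_equiv {σ τ υ : Type*} (e : σ ≃ τ) (e' : τ ≃ υ) (g : MvPolynomial σ K) :
    rename e' (rename e g) = rename (e.trans e') g := by
  rw [rename_rename]; rfl

/-- Compatible families are compatible with all permutations. -/
theorem rename_perm_of_compatible {f : Seq ν → MvPolynomial (Fin (ht ν)) K}
    (hf : ∀ k hk s, rename (adj k hk) (f (s.swap k hk)) = f s) (σ : Perm (Fin (ht ν)))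
    (s : Seq ν) : rename σ (f (s.perm σ)) = f s := by
  induction σ using perm_induction generalizing s with
  | one => exact rename_id_apply _
  | mul σ τ h1 h2 => rw [Seq.perm_mul, Perm.coe_mul, ← rename_rename, h2, h1]
  | adj k hk => exact hf k hk s

variable (K) in
/-- The family of polynomials attached to a polynomial in the labels. -/
noncomputable def family (v : Seq ν → (Σ k, Fin (m k)) ≃ Fin (ht ν)) :
    MvPolynomial (Σ k, Fin (m k)) K →ₐ[K] (Seq ν → MvPolynomial (Fin (ht ν)) K) :=
  AlgHom.pi fun s => rename (v s)

variable {v : Seq ν → (Σ k, Fin (m k)) ≃ Fin (ht ν)}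

theorem family_apply (g : MvPolynomial (Σ k, Fin (m k)) K) (s : Seq ν) :
    family K v g s = rename (v s) g := rfl

theorem family_injective [Nonempty (Seq ν)] : Function.Injective (family K v) := fun _ _ h =>
  rename_injective _ (v (Classical.arbitrary _)).injective (congrFun h (Classical.arbitrary _))

theorem family_compatible (hi : Function.Injective i) (hv : ∀ s x, (s : Seq ν).1 (v s x) = i x.1)
    {g : MvPolynomial (Σ k, Fin (m k)) K} (hg : IsInvariant g) (k : ℕ) (hk : k + 1 < ht ν)
    (s : Seq ν) : rename (adj k hk) (family K v g (s.swap k hk)) = family K v g s := by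
  -- The two labellings, compared through the transposition, differ by a permutation preserving
  -- labels. Injectivity of `i` turns this into preserving the blocks of variables, under which `g`
  -- is invariant.
  obtain ⟨τ, hτ⟩ := exists_sigmaCongrRight
    (((v (s.swap k hk)).trans (adj k hk)).trans (v s).symm) (fun x => hi (by
      rw [← hv s, ← hv (s.swap k hk)]
      simp))
  have h := hg τ
  rw [family_apply, family_apply, rename_rename_equiv]
  conv_rhs => rw [← h, hτ, rename_rename_equiv]
  congr 2
  ext x
  simp

/-- Any two sequences are related by a permutation of positions, and the permutations available are
those of labellings composed with block permutations. The member at one base sequence thus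
determines all others, and its own compatibility is the invariance. -/
theorem exists_family (hv : ∀ s x, (s : Seq ν).1 (v s x) = i x.1) [Nonempty (Seq ν)]
    {f : Seq ν → MvPolynomial (Fin (ht ν)) K}
    (hf : ∀ k hk s, rename (adj k hk) (f (s.swap k hk)) = f s) :
    ∃ g, IsInvariant g ∧ family K v g = f := by
  let s₀ : Seq ν := Classical.arbitrary _
  have key (s : Seq ν) (σ : Perm (Σ k, Fin (m k))) (hσ : ∀ x, (σ x).1 = x.1) :
      rename (((v s₀).symm.trans σ).trans (v s)) (f s₀) = f s := by
    rw [← rename_perm_of_compatible hf (((v s₀).symm.trans σ).trans (v s)) s]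
    congr 2
    apply Subtype.ext
    funext p
    rw [Seq.perm_apply, trans_apply, hv, trans_apply, hσ, ← hv s₀, apply_symm_apply]
  refine ⟨rename (v s₀).symm (f s₀), fun τ => ?_, funext fun s => ?_⟩
  · rw [rename_rename_equiv]
    -- The permutation that `τ` induces on positions fixes the base sequence, so compatibility
    -- compares its member with itself.
    conv_rhs => rw [← key s₀ (Equiv.sigmaCongrRight τ) fun x => rfl, rename_rename_equiv]
    congr 2
    ext1 x
    simp
  · rw [family_apply, rename_rename_equiv, ← key s 1 fun x => rfl]
    rfl

theorem isWeightedHomogeneous_rename_iff {σ τ : Type*} (e : σ ≃ τ) (w : τ → ℤ)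
    (g : MvPolynomial σ K) (d : ℤ) :
    IsWeightedHomogeneous w (rename e g) d ↔ IsWeightedHomogeneous (w ∘ e) g d := by
  have hw (q : σ →₀ ℕ) : Finsupp.weight w (q.mapDomain e) = Finsupp.weight (w ∘ e) q := by
    rw [Finsupp.weight_apply, Finsupp.weight_apply, Finsupp.sum_mapDomain_index] <;>
      simp [add_mul]
  constructor
  · intro h q hq
    rw [← hw]
    exact h (by rwa [coeff_rename_mapDomain _ e.injective])
  · intro h q hq
    obtain ⟨q, rfl, hq'⟩ := coeff_rename_ne_zero _ _ _ hq
    rw [hw]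
    exact h hq'

theorem family_homogeneous_iff (hv : ∀ s x, (s : Seq ν).1 (v s x) = i x.1) [Nonempty (Seq ν)]
    (g : MvPolynomial (Σ k, Fin (m k)) K) (d : ℤ) :
    (∀ s, IsWeightedHomogeneous (dotWeight D s) (family K v g s) d) ↔
      IsWeightedHomogeneous (fun x : Σ k, Fin (m k) => 2 * D.r (i x.1)) g d := by
  have h (s : Seq ν) : dotWeight D s ∘ v s = fun x : Σ k, Fin (m k) => 2 * D.r (i x.1) :=
    funext fun x => by rw [Function.comp_apply, dotWeight, hv]
  simp only [family_apply, isWeightedHomogeneous_rename_iff, h]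
  exact forall_const _

end Main

end QuiverHecke

/-! ### The graded isomorphism -/

theorem mainTheorem11 {K : Type*} [Field K] [IsAlgClosed K]
    {I : Type*} [Fintype I] [DecidableEq I] (D : BorcherdsCartanDatum I)
    (ν : I → ℕ) {t : ℕ} (i : Fin t → I) (hi : Function.Injective i)
    (m : Fin t → ℕ) (hm : ∀ k, 0 < m k) (hν : ν = ∑ k, Pi.single (i k) (m k)) :
    ∃ e : Subalgebra.center K (QuiverHecke.R K D ν) ≃ₐ[K] QuiverHecke.SymTensor K m,
      ∀ (d : ℤ) (z : Subalgebra.center K (QuiverHecke.R K D ν)),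
        (z : QuiverHecke.R K D ν) ∈ QuiverHecke.homogeneousPart K D ν d ↔
          e z ∈ QuiverHecke.SymTensor.homogeneousPart K m (fun k => 2 * D.r (i k)) d := by
  open QuiverHecke in
  have := nonempty_seq hν
  choose v hv using exists_labelling hi hν
  -- The map is built from the tensor product into `R(ν)`, where it is visibly multiplicative. The
  -- required isomorphism is the inverse of its restriction to the center.
  let Θ : SymTensor K m →ₐ[K] R K D ν := (diagonal K D ν).comp ((family K v).comp (joinSym K m))
  have hΘ (x : SymTensor K m) : Θ x = diagonal K D ν (family K v (joinSym K m x)) := rfl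
  have hinj : Function.Injective Θ :=
    diagonal_injective.comp (family_injective.comp joinSym_injective)
  have hmem (x : SymTensor K m) : Θ x ∈ Subalgebra.center K (R K D ν) := by
    rw [Subalgebra.mem_center_iff, hΘ, diagonal_central_iff]
    exact family_compatible hi hv (isInvariant_joinSym x)
  have hbij : Function.Bijective (Θ.codRestrict (Subalgebra.center K (R K D ν)) hmem) := by
    refine ⟨(AlgHom.injective_codRestrict _ _ _).2 hinj, fun z => ?_⟩
    have hz := Subalgebra.mem_center_iff.1 z.2
    obtain ⟨f, hf⟩ := exists_diagonal_of_central hz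
    rw [← hf, diagonal_central_iff] at hz
    obtain ⟨g, hg, rfl⟩ := exists_family hv hz
    -- No degree condition is wanted here, so the submodule is everything.
    obtain ⟨x, -, rfl⟩ := exists_joinSym ⊤ g hg fun _ _ => trivial
    exact ⟨x, Subtype.ext hf⟩
  refine ⟨(AlgEquiv.ofBijective _ hbij).symm, fun d z => ?_⟩
  obtain ⟨x, rfl⟩ := (AlgEquiv.ofBijective _ hbij).surjective z
  rw [AlgEquiv.symm_apply_apply, mem_symTensor_homogeneousPart_iff, ← family_homogeneous_iff hv,
    ← diagonal_mem_homogeneousPart_iff]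
  rfl
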